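/- For $f:\mathbb{R}^3\to\mathbb{C}$ let $\widehat f(\xi)=\int_{\mathbb{R}^3}e^{-ix\cdot\xi}f(x)\,dx$, let $\langle x\rangle=\sqrt{1+|x|^2}$, let $\|f\|_{H^{s}}=(2\pi)^{-3/2}\|\langle\xi\rangle^{s}\widehat f\|_{L^2}$, and let $$\big(e^{it\sqrt{1-\Delta}}f\big)(x)=\frac1{(2\pi)^3}\int_{\mathbb{R}^3}e^{ix\cdot\xi}\,e^{it\sqrt{1+|\xi|^2}}\,\widehat f(\xi)\,d\xi .$$ There is an absolute constant $C$ such that for every measurable $f:\mathbb{R}^3\to\mathbb{C}$ with $\langle x\rangle^2f\in L^2(\mathbb{R}^3)$ and $(1+|\xi|)^6\widehat f\in L^\infty(\mathbb{R}^3)$, and for every $t\in\mathbb{R}$, $$\big\|e^{it\sqrt{1-\Delta}}f\big\|_{L^\infty}\le C\left(\frac{1}{(1+|t|)^{3/2}}\,\big\|(1+|\xi|)^6\widehat f(\xi)\big\|_{L^\infty_\xi}+\frac{1}{(1+|t|)^{31/20}}\Big[\big\|\langle x\rangle^2f\big\|_{L^2}+\|f\|_{H^{50}}\Big]\right),$$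 where the right-hand side is $+\infty$ if $f\notin H^{50}(\mathbb{R}^3)$. -/

import Mathlib

open MeasureTheory
open scoped ENNReal NNReal

noncomputable section

/-- Three-dimensional Euclidean space. -/
abbrev R3 : Type := EuclideanSpace ℝ (Fin 3)

/-- The Japanese bracket `⟨x⟩ = √(1 + |x|²)`. -/
def japaneseBracket (x : R3) : ℝ := Real.sqrt (1 + ‖x‖ ^ 2)

/-- The Fourier transform with the normalization `f̂(ξ) = ∫ e^{-i x·ξ} f(x) dx`. -/
def fourierHat (f : R3 → ℂ) (ξ : R3) : ℂ :=
  ∫ x : R3, Complex.exp (-Complex.I * ((inner ℝ x ξ : ℝ) : ℂ)) * f x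

/-- The Fourier multiplier operator with symbol `m`:
`(m(∇/i) f)(x) = (2π)⁻³ ∫ e^{i x·ξ} m(ξ) f̂(ξ) dξ`. -/
def fourierMultiplierOp (m : R3 → ℂ) (f : R3 → ℂ) (x : R3) : ℂ :=
  (((2 * Real.pi) ^ 3)⁻¹ : ℝ) *
    ∫ ξ : R3, Complex.exp (Complex.I * ((inner ℝ x ξ : ℝ) : ℂ)) * (m ξ * fourierHat f ξ)

/-- The propagator `e^{it√(1-Δ)}`; since `-Δ` has symbol `|ξ|²`, it is the Fourier multiplier
with symbol `e^{it√(1+|ξ|²)}`. -/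
def propagator (t : ℝ) (f : R3 → ℂ) : R3 → ℂ :=
  fourierMultiplierOp (fun ξ => Complex.exp (Complex.I * (t : ℂ) * (japaneseBracket ξ : ℂ))) f

/-- The Sobolev norm `‖f‖_{H^s} = (2π)^{-3/2} ‖⟨ξ⟩^s f̂‖_{L²}`, with value `∞` when the integrable
function `f` is not in `H^s`. -/
def sobolevENorm (s : ℕ) (f : R3 → ℂ) : ℝ≥0∞ :=
  ENNReal.ofReal ((2 * Real.pi) ^ (-(3 / 2) : ℝ)) *
    eLpNorm (fun ξ : R3 => ((japaneseBracket ξ ^ s : ℝ) : ℂ) * fourierHat f ξ) 2 volume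

/-- The weighted norm `‖⟨x⟩² f‖_{L²}` is taken of this function. -/
def weightedFun (f : R3 → ℂ) (x : R3) : ℂ := ((japaneseBracket x ^ 2 : ℝ) : ℂ) * f x

/-- The function `(1 + |ξ|)⁶ f̂(ξ)`. -/
def weightedHat (f : R3 → ℂ) (ξ : R3) : ℂ := (((1 + ‖ξ‖) ^ 6 : ℝ) : ℂ) * fourierHat f ξ

end

/-! With `c = x / t`, the propagator is a constant times the integral of `exp (i t φ) f̂`, where
`φ(ξ) = ⟨ξ⟩ + c · ξ` has gradient `p + c` and `p = ξ / ⟨ξ⟩` is the group velocity. The map `ξ ↦ p`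
is injective with Jacobian `⟨ξ⟩⁻⁵`, so in the variable `p` the phase fails to oscillate only on a
ball of radius about `|t|^(-1/2)` around `-c`, whose volume gives the rate `|t|^(-3/2)`. The weight
`(1 + |ξ|)⁶` more than pays for the Jacobian.

To exploit this, the integral is integrated by parts twice along `b = r (p + c)` with `r = (1 + τ |p
+ c|²)⁻¹`, `τ = |t|` (`integral_phaseExp_mul_eq`). The damping makes the operator regular at the
stationary point, so no decomposition of frequency space around it is needed. With `y = |p + c|` and
amplitude `G`, the new integrand is controlled by `(1 + y) r² |G| + y r² |∇G| + y² r² |∇²G|`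
(`norm_ibpOp_ibpOp_le`).

The one integral estimate used is that `⟨ξ⟩⁻⁵ r^(9/5)` has integral `O(τ^(-3/2))`
(`lintegral_damping_le`). It bounds the first term by the weighted sup norm of `G` at the sharp
rate. In the other two terms it is combined with Hölder, and with the Sobolev embedding of `∇G` into
`L⁶`; both are then `O(τ^(-7/4))` times the `L²` norm of `∇²G`, with a loss `K^(25/6)` if `G` lives
on frequencies of size at most `2K` (`enorm_integral_phaseExp_mul_le`).

By Plancherel the `H²` norm of `f̂` is bounded by the norm of `⟨x⟩² f`. Frequencies above `K` are
estimated trivially through `H^50`, gaining `K^(-48)`. Taking `K = |t|^(1/25)` puts both remainders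
below `|t|^(-31/20)`. For `|t| < 1` the integral of `|f̂|` suffices. -/

noncomputable section

/-! ### The Japanese bracket and the group velocity -/

lemma japaneseBracket_sq (ξ : R3) : japaneseBracket ξ ^ 2 = 1 + ‖ξ‖ ^ 2 :=
  Real.sq_sqrt (by positivity)

lemma japaneseBracket_pos (ξ : R3) : 0 < japaneseBracket ξ :=
  Real.sqrt_pos.2 (by positivity)

lemma one_le_japaneseBracket (ξ : R3) : 1 ≤ japaneseBracket ξ :=
  Real.one_le_sqrt.2 (by nlinarith [sq_nonneg ‖ξ‖])

lemma norm_le_japaneseBracket (ξ : R3) : ‖ξ‖ ≤ japaneseBracket ξ :=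
  Real.le_sqrt_of_sq_le (by linarith)

lemma contDiff_japaneseBracket {n : WithTop ℕ∞} : ContDiff ℝ n japaneseBracket := by
  unfold japaneseBracket
  exact (contDiff_const.add (contDiff_norm_sq ℝ)).sqrt (fun x => by positivity)

/-- The gradient `ξ / ⟨ξ⟩` of the Japanese bracket. -/
def velocity (ξ : R3) : R3 := (japaneseBracket ξ)⁻¹ • ξ

lemma contDiff_velocity {n : WithTop ℕ∞} : ContDiff ℝ n velocity :=
  (contDiff_japaneseBracket.inv fun x => (japaneseBracket_pos x).ne').smul contDiff_id

lemma norm_velocity_sq (ξ : R3) : ‖velocity ξ‖ ^ 2 = 1 - (japaneseBracket ξ)⁻¹ ^ 2 := by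
  have h := japaneseBracket_sq ξ
  have h0 := japaneseBracket_pos ξ
  rw [velocity, norm_smul, mul_pow, Real.norm_of_nonneg (by positivity)]
  field_simp
  linarith

lemma norm_velocity_le_one (ξ : R3) : ‖velocity ξ‖ ≤ 1 := by
  have := norm_velocity_sq ξ
  nlinarith [sq_nonneg ((japaneseBracket ξ)⁻¹), norm_nonneg (velocity ξ)]

lemma hasFDerivAt_japaneseBracket (ξ : R3) :
    HasFDerivAt japaneseBracket (innerSL ℝ (velocity ξ)) ξ := by
  have h1 : HasFDerivAt (fun x : R3 => 1 + ‖x‖ ^ 2) (2 • innerSL ℝ ξ) ξ :=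
    (hasStrictFDerivAt_norm_sq ξ).hasFDerivAt.const_add 1
  have h := h1.sqrt (by positivity : (1 + ‖ξ‖ ^ 2) ≠ 0)
  refine h.congr_fderiv ?_
  ext w
  simp [velocity, japaneseBracket]
  ring

lemma hasFDerivAt_inv_japaneseBracket (ξ : R3) :
    HasFDerivAt (fun x => (japaneseBracket x)⁻¹)
      (-((japaneseBracket ξ)⁻¹ ^ 2) • innerSL ℝ (velocity ξ)) ξ := by
  have h := (hasDerivAt_inv (japaneseBracket_pos ξ).ne').comp_hasFDerivAt ξ
    (hasFDerivAt_japaneseBracket ξ)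
  refine h.congr_fderiv ?_
  ext w
  simp

/-- The derivative `w ↦ ⟨ξ⟩⁻¹ (w - (p · w) p)` of `p = velocity`. -/
def velocityDeriv (ξ : R3) : R3 →L[ℝ] R3 :=
  (japaneseBracket ξ)⁻¹ • ContinuousLinearMap.id ℝ R3 -
    ((japaneseBracket ξ)⁻¹ • innerSL ℝ (velocity ξ)).smulRight (velocity ξ)

lemma velocityDeriv_apply (ξ w : R3) : velocityDeriv ξ w =
    (japaneseBracket ξ)⁻¹ • w - ((japaneseBracket ξ)⁻¹ * inner ℝ (velocity ξ) w) • velocity ξ := by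
  simp [velocityDeriv]

lemma hasFDerivAt_velocity (ξ : R3) : HasFDerivAt velocity (velocityDeriv ξ) ξ := by
  have h := (hasFDerivAt_inv_japaneseBracket ξ).smul (hasFDerivAt_id ξ)
  refine h.congr_fderiv ?_
  ext1 w
  rw [velocityDeriv_apply]
  simp only [id_eq, _root_.add_apply, _root_.smul_apply,
    ContinuousLinearMap.smulRight_apply, innerSL_apply_apply, ContinuousLinearMap.id_apply,
    smul_eq_mul]
  rw [sub_eq_add_neg, ← neg_smul]
  congr 1
  rw [show velocity ξ = (japaneseBracket ξ)⁻¹ • ξ from rfl, smul_smul]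
  congr 1
  ring

lemma norm_velocityDeriv_apply_le (ξ w : R3) : ‖velocityDeriv ξ w‖ ≤ 2 * ‖w‖ := by
  have hp := norm_velocity_le_one ξ
  have ha : (japaneseBracket ξ)⁻¹ ≤ 1 := inv_le_one_of_one_le₀ (one_le_japaneseBracket ξ)
  have ha0 : 0 < (japaneseBracket ξ)⁻¹ := inv_pos.2 (japaneseBracket_pos ξ)
  have hi : |inner ℝ (velocity ξ) w| ≤ ‖w‖ :=
    (abs_real_inner_le_norm _ _).trans (mul_le_of_le_one_left (norm_nonneg _) hp)
  rw [velocityDeriv_apply]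
  refine (norm_sub_le _ _).trans ?_
  rw [norm_smul, norm_smul, norm_mul, Real.norm_of_nonneg ha0.le, Real.norm_eq_abs]
  have h1 : (japaneseBracket ξ)⁻¹ * ‖w‖ ≤ ‖w‖ := mul_le_of_le_one_left (norm_nonneg _) ha
  have h2 : (japaneseBracket ξ)⁻¹ * |inner ℝ (velocity ξ) w| * ‖velocity ξ‖ ≤ ‖w‖ := by
    refine (mul_le_of_le_one_right (by positivity) hp).trans ?_
    exact (mul_le_of_le_one_left (abs_nonneg _) ha).trans hi
  linarith

/-! ### The damped vector field and its divergence -/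

section Field

variable (τ : ℝ) (c : R3)

/-- The damping factor `(1 + τ |p + c|²)⁻¹`. -/
def damping (ξ : R3) : ℝ := (1 + τ * ‖velocity ξ + c‖ ^ 2)⁻¹

/-- The vector field along which the oscillatory integral is integrated by parts. -/
def ibpField (ξ : R3) : R3 := damping τ c ξ • (velocity ξ + c)

/-- The divergence of `ibpField`. -/
def ibpDiv (ξ : R3) : ℝ :=
  damping τ c ξ * (2 * (japaneseBracket ξ)⁻¹ + (japaneseBracket ξ)⁻¹ ^ 3) -
    2 * τ * damping τ c ξ ^ 2 * (japaneseBracket ξ)⁻¹ *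
      (‖velocity ξ + c‖ ^ 2 - inner ℝ (velocity ξ) (velocity ξ + c) ^ 2)

variable {τ}

lemma damping_pos (hτ : 0 ≤ τ) (ξ : R3) : 0 < damping τ c ξ := by
  unfold damping; positivity

lemma damping_le_one (hτ : 0 ≤ τ) (ξ : R3) : damping τ c ξ ≤ 1 :=
  inv_le_one_of_one_le₀ (by nlinarith [mul_nonneg hτ (sq_nonneg ‖velocity ξ + c‖)])

lemma damping_mul (hτ : 0 ≤ τ) (ξ : R3) :
    damping τ c ξ * (1 + τ * ‖velocity ξ + c‖ ^ 2) = 1 :=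
  inv_mul_cancel₀ (by positivity)

lemma contDiff_damping (hτ : 0 ≤ τ) {n : WithTop ℕ∞} : ContDiff ℝ n (damping τ c) := by
  unfold damping
  refine ContDiff.inv ?_ (fun x => by positivity)
  exact contDiff_const.add (contDiff_const.mul
    ((contDiff_norm_sq ℝ).comp (contDiff_velocity.add contDiff_const)))

lemma contDiff_ibpField (hτ : 0 ≤ τ) {n : WithTop ℕ∞} : ContDiff ℝ n (ibpField τ c) :=
  (contDiff_damping c hτ).smul (contDiff_velocity.add contDiff_const)

lemma contDiff_inv_japaneseBracket {n : WithTop ℕ∞} :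
    ContDiff ℝ n (fun x => (japaneseBracket x)⁻¹) :=
  contDiff_japaneseBracket.inv fun x => (japaneseBracket_pos x).ne'

lemma contDiff_ibpDiv (hτ : 0 ≤ τ) {n : WithTop ℕ∞} : ContDiff ℝ n (ibpDiv τ c) := by
  have h1 : ContDiff ℝ n (damping τ c) := contDiff_damping c hτ
  have h2 : ContDiff ℝ n (fun x => (japaneseBracket x)⁻¹) := contDiff_inv_japaneseBracket
  have h3 : ContDiff ℝ n (fun x => velocity x + c) := contDiff_velocity.add contDiff_const
  have h4 : ContDiff ℝ n (fun x => ‖velocity x + c‖ ^ 2) := (contDiff_norm_sq ℝ).comp h3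
  have h5 : ContDiff ℝ n (fun x => inner ℝ (velocity x) (velocity x + c)) :=
    contDiff_velocity.inner ℝ h3
  unfold ibpDiv
  fun_prop

lemma hasFDerivAt_damping (hτ : 0 ≤ τ) (ξ : R3) :
    HasFDerivAt (damping τ c) (-(damping τ c ξ ^ 2) • τ • 2 •
      (innerSL ℝ (velocity ξ + c)).comp (velocityDeriv ξ)) ξ := by
  have h3 : HasFDerivAt (fun x => velocity x + c) (velocityDeriv ξ) ξ :=
    (hasFDerivAt_velocity ξ).add_const c
  have h4 : HasFDerivAt (fun x => 1 + τ * ‖velocity x + c‖ ^ 2) _ ξ :=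
    (h3.norm_sq.const_mul τ).const_add 1
  have h := (hasDerivAt_inv (by positivity : (1 + τ * ‖velocity ξ + c‖ ^ 2) ≠ 0)).comp_hasFDerivAt
    ξ h4
  refine h.congr_fderiv ?_
  ext w
  simp [damping]

/-- Write `a = ⟨ξ⟩⁻¹`. The derivative of the velocity is `a (1 - p ⊗ p)`, of trace `a (3 - |p|²) = 2
a + a³`. The second term of `ibpDiv` is the derivative of the damping factor in the direction `p +
c`. -/
lemma sum_fderiv_ibpField (hτ : 0 ≤ τ) (ξ : R3) :
    ∑ i : Fin 3, (fderiv ℝ (ibpField τ c) ξ (EuclideanSpace.single i 1)) i = ibpDiv τ c ξ := by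
  have h3 : HasFDerivAt (fun x => velocity x + c) (velocityDeriv ξ) ξ :=
    (hasFDerivAt_velocity ξ).add_const c
  have h : HasFDerivAt (ibpField τ c) _ ξ := (hasFDerivAt_damping c hτ ξ).smul h3
  rw [h.fderiv]
  have hp := norm_velocity_sq ξ
  rw [EuclideanSpace.norm_sq_eq] at hp
  simp only [Fin.sum_univ_three, Real.norm_eq_abs, sq_abs] at hp
  unfold ibpDiv
  rw [EuclideanSpace.norm_sq_eq]
  simp only [PiLp.inner_apply, _root_.add_apply, _root_.smul_apply,
    ContinuousLinearMap.smulRight_apply, ContinuousLinearMap.comp_apply, innerSL_apply_apply,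
    velocityDeriv_apply, PiLp.add_apply, PiLp.sub_apply, PiLp.smul_apply, smul_eq_mul,
    Fin.sum_univ_three, Real.norm_eq_abs, sq_abs, RCLike.inner_apply, conj_trivial]
  simp [-inv_pow]
  generalize (japaneseBracket ξ)⁻¹ = a at *
  generalize velocity ξ = p at *
  generalize damping τ c ξ = r at *
  linear_combination (-a * r) * hp

end Field
end

/-! ### Bounds on the field, its divergence and their derivatives along the field -/

noncomputable section

section Field

variable (c : R3) {τ : ℝ}

/-- This is the absorption behind all the bounds of this part: a factor `τ y²` produced by
differentiating the damping is paid for by one power of `r`, so no positive power of `τ` survives.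
-/
lemma mul_damping_mul_sq_le_one (hτ : 0 ≤ τ) (ξ : R3) :
    τ * damping τ c ξ * ‖velocity ξ + c‖ ^ 2 ≤ 1 := by
  nlinarith [damping_mul c hτ ξ, damping_pos c hτ ξ]

lemma abs_ibpDiv_le (hτ : 0 ≤ τ) (ξ : R3) : |ibpDiv τ c ξ| ≤ 5 * damping τ c ξ := by
  have hr := damping_pos c hτ ξ
  have hu := mul_damping_mul_sq_le_one c hτ ξ
  have ha : (japaneseBracket ξ)⁻¹ ≤ 1 := inv_le_one_of_one_le₀ (one_le_japaneseBracket ξ)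
  have ha0 : 0 < (japaneseBracket ξ)⁻¹ := inv_pos.2 (japaneseBracket_pos ξ)
  have hn : inner ℝ (velocity ξ) (velocity ξ + c) ^ 2 ≤ ‖velocity ξ + c‖ ^ 2 := by
    rw [sq_le_sq, abs_norm]
    exact (abs_real_inner_le_norm _ _).trans
      (mul_le_of_le_one_left (norm_nonneg _) (norm_velocity_le_one ξ))
  have hn0 := sq_nonneg (inner ℝ (velocity ξ) (velocity ξ + c))
  unfold ibpDiv
  generalize (japaneseBracket ξ)⁻¹ = a at *
  generalize inner ℝ (velocity ξ) (velocity ξ + c) ^ 2 = n at *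
  generalize ‖velocity ξ + c‖ ^ 2 = N at *
  generalize damping τ c ξ = r at *
  have h1 : a ^ 3 ≤ 1 := pow_le_one₀ ha0.le ha
  have h2 : τ * r * (N - n) ≤ 1 := by nlinarith [mul_nonneg (mul_nonneg hτ hr.le) hn0]
  have h3 : 0 ≤ τ * r * (N - n) := mul_nonneg (mul_nonneg hτ hr.le) (by linarith)
  have h4 : 0 ≤ τ * r * (N - n) * a := mul_nonneg h3 ha0.le
  have h5 : τ * r * (N - n) * a ≤ 1 := mul_le_one₀ h2 ha0.le ha
  have h6 : r * (2 * a + a ^ 3) - 2 * τ * r ^ 2 * a * (N - n) =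
    r * (2 * a + a ^ 3 - 2 * (τ * r * (N - n) * a)) := by ring
  rw [h6, abs_mul, abs_of_pos hr, mul_comm]
  refine mul_le_mul_of_nonneg_right (abs_le.2 ⟨?_, ?_⟩) hr.le <;> nlinarith [pow_pos ha0 3]

lemma norm_ibpField (hτ : 0 ≤ τ) (ξ : R3) :
    ‖ibpField τ c ξ‖ = damping τ c ξ * ‖velocity ξ + c‖ := by
  rw [ibpField, norm_smul, Real.norm_of_nonneg (damping_pos c hτ ξ).le]

/-- The derivative is `-2 τ r² (p + c) · Dp(b)`, and `|Dp(b)| ≤ 2 |b| = 2 r y`. The result is at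
most `4 r² (τ r y²)`, and the bracket is at most one. Differentiating along the field thus gains a
power of `r`. -/
lemma abs_fderiv_damping_le (hτ : 0 ≤ τ) (ξ : R3) :
    |fderiv ℝ (damping τ c) ξ (ibpField τ c ξ)| ≤ 4 * damping τ c ξ ^ 2 := by
  rw [(hasFDerivAt_damping c hτ ξ).fderiv]
  have hr := damping_pos c hτ ξ
  have hu := mul_damping_mul_sq_le_one c hτ ξ
  have hb := norm_ibpField c hτ ξ
  have h1 := norm_velocityDeriv_apply_le ξ (ibpField τ c ξ)
  have h2 := abs_real_inner_le_norm (velocity ξ + c) (velocityDeriv ξ (ibpField τ c ξ))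
  simp only [_root_.smul_apply, ContinuousLinearMap.comp_apply, innerSL_apply_apply, smul_eq_mul,
    nsmul_eq_mul]
  rw [abs_mul, abs_mul, abs_mul, abs_neg, abs_of_nonneg (sq_nonneg (damping τ c ξ)),
    abs_of_nonneg hτ]
  generalize inner ℝ (velocity ξ + c) (velocityDeriv ξ (ibpField τ c ξ)) = v at *
  rw [hb] at h1
  generalize ‖velocityDeriv ξ (ibpField τ c ξ)‖ = V at *
  have hy := norm_nonneg (velocity ξ + c)
  generalize ‖velocity ξ + c‖ = y at *
  generalize damping τ c ξ = r at *
  have h3 : |v| ≤ 2 * r * y ^ 2 := by nlinarith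
  have h4 : τ * |v| ≤ 2 := by nlinarith
  norm_num
  nlinarith [sq_nonneg r]

lemma norm_fderiv_ibpField_le (hτ : 0 ≤ τ) (ξ : R3) :
    ‖fderiv ℝ (ibpField τ c) ξ (ibpField τ c ξ)‖ ≤
      6 * damping τ c ξ ^ 2 * ‖velocity ξ + c‖ := by
  have h3 : HasFDerivAt (fun x => velocity x + c) (velocityDeriv ξ) ξ :=
    (hasFDerivAt_velocity ξ).add_const c
  have h : HasFDerivAt (ibpField τ c) _ ξ :=
    ((contDiff_damping c hτ (n := 1)).differentiable one_ne_zero ξ).hasFDerivAt.smul h3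
  rw [h.fderiv]
  have h1 := norm_velocityDeriv_apply_le ξ (ibpField τ c ξ)
  have h2 := abs_fderiv_damping_le c hτ ξ
  have hr := damping_pos c hτ ξ
  rw [norm_ibpField c hτ] at h1
  simp only [_root_.add_apply, _root_.smul_apply, ContinuousLinearMap.smulRight_apply]
  refine (norm_add_le _ _).trans ?_
  rw [norm_smul, norm_smul, Real.norm_of_nonneg hr.le, Real.norm_eq_abs]
  nlinarith [norm_nonneg (velocity ξ + c), mul_le_mul_of_nonneg_right h2 (norm_nonneg (velocity ξ + c)),
    mul_le_mul_of_nonneg_left h1 hr.le]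

/-- The real-variable inequality behind `abs_fderiv_ibpDiv_le`. -/
lemma abs_ibpDiv_deriv_bound {a r y n a' r' N' n' : ℝ} (hτ : 0 ≤ τ) (ha0 : 0 ≤ a) (ha : a ≤ 1)
    (hr : 0 < r) (hy : 0 ≤ y) (hu : τ * r * y ^ 2 ≤ 1) (hn : |n| ≤ y) (ha' : |a'| ≤ r * y)
    (hr' : |r'| ≤ 4 * r ^ 2) (hN' : |N'| ≤ 4 * r * y ^ 2) (hn' : |n'| ≤ 2 * r * y ^ 2 + 2 * r * y) :
    |r' * (2 * a + a ^ 3) + r * (2 * a' + 3 * a ^ 2 * a') -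
      ((2 * τ * (2 * r * r') * a + 2 * τ * r ^ 2 * a') * (y ^ 2 - n ^ 2) +
        2 * τ * r ^ 2 * a * (N' - 2 * n * n'))| ≤ 44 * (1 + y) * r ^ 2 := by
  have hn2 : |y ^ 2 - n ^ 2| ≤ y ^ 2 := by
    rw [abs_le]; constructor <;> nlinarith [sq_abs n, abs_nonneg n]
  have h1 : |r' * (2 * a + a ^ 3)| ≤ 12 * r ^ 2 := by
    rw [abs_mul, abs_of_nonneg (by positivity : 0 ≤ 2 * a + a ^ 3)]
    have : 2 * a + a ^ 3 ≤ 3 := by nlinarith [pow_le_one₀ (n := 3) ha0 ha]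
    calc _ ≤ (4 * r ^ 2) * 3 := by gcongr
      _ = _ := by ring
  have h2 : |r * (2 * a' + 3 * a ^ 2 * a')| ≤ 5 * y * r ^ 2 := by
    rw [show r * (2 * a' + 3 * a ^ 2 * a') = r * (2 + 3 * a ^ 2) * a' by ring, abs_mul,
      abs_of_nonneg (by positivity : 0 ≤ r * (2 + 3 * a ^ 2))]
    have : 2 + 3 * a ^ 2 ≤ 5 := by nlinarith
    calc _ ≤ r * 5 * (r * y) := by gcongr
      _ = _ := by ring
  have h3 : |2 * τ * (2 * r * r') * a * (y ^ 2 - n ^ 2)| ≤ 16 * r ^ 2 := by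
    rw [show 2 * τ * (2 * r * r') * a * (y ^ 2 - n ^ 2) = (4 * τ * r * a) * r' * (y ^ 2 - n ^ 2)
      by ring, abs_mul, abs_mul, abs_of_nonneg (by positivity : 0 ≤ 4 * τ * r * a)]
    calc _ ≤ 4 * τ * r * 1 * (4 * r ^ 2) * y ^ 2 := by gcongr
      _ = 16 * r ^ 2 * (τ * r * y ^ 2) := by ring
      _ ≤ 16 * r ^ 2 * 1 := by gcongr
      _ = _ := by ring
  have h4 : |2 * τ * r ^ 2 * a' * (y ^ 2 - n ^ 2)| ≤ 2 * y * r ^ 2 := by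
    rw [abs_mul, abs_mul, abs_of_nonneg (by positivity : 0 ≤ 2 * τ * r ^ 2)]
    calc _ ≤ 2 * τ * r ^ 2 * (r * y) * y ^ 2 := by gcongr
      _ = 2 * y * r ^ 2 * (τ * r * y ^ 2) := by ring
      _ ≤ 2 * y * r ^ 2 * 1 := by gcongr
      _ = _ := by ring
  have h5 : |2 * τ * r ^ 2 * a * (N' - 2 * n * n')| ≤ 8 * r ^ 2 + 8 * (1 + y) * r ^ 2 := by
    have h6 : |N' - 2 * n * n'| ≤ 4 * r * y ^ 2 + 2 * y * (2 * r * y ^ 2 + 2 * r * y) := by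
      refine (abs_sub _ _).trans (add_le_add hN' ?_)
      rw [abs_mul, abs_mul, abs_two]
      gcongr
    rw [abs_mul, abs_of_nonneg (by positivity : 0 ≤ 2 * τ * r ^ 2 * a)]
    calc _ ≤ 2 * τ * r ^ 2 * 1 * (4 * r * y ^ 2 + 2 * y * (2 * r * y ^ 2 + 2 * r * y)) := by gcongr
      _ = (8 * r ^ 2 + 8 * (1 + y) * r ^ 2) * (τ * r * y ^ 2) := by ring
      _ ≤ (8 * r ^ 2 + 8 * (1 + y) * r ^ 2) * 1 := by gcongr
      _ = _ := by ring
  rw [abs_le] at *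
  constructor <;> nlinarith [mul_nonneg hy (sq_nonneg r)]

lemma abs_fderiv_ibpDiv_le (hτ : 0 ≤ τ) (ξ : R3) :
    |fderiv ℝ (ibpDiv τ c) ξ (ibpField τ c ξ)| ≤
      44 * (1 + ‖velocity ξ + c‖) * damping τ c ξ ^ 2 := by
  set w := ibpField τ c ξ with hw
  have hY : HasFDerivAt (fun x => velocity x + c) (velocityDeriv ξ) ξ :=
    (hasFDerivAt_velocity ξ).add_const c
  have hline : HasDerivAt (fun s : ℝ => ξ + s • w) w 0 := by
    simpa using ((hasDerivAt_id (0 : ℝ)).smul_const w).const_add ξ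
  have h0 : ξ + (0 : ℝ) • w = ξ := by simp
  -- Only the directional derivative along the fixed vector `w` is needed, so every ingredient is
  -- restricted to the line `ξ + s w` and the one-variable product rule applies.
  have key : ∀ {F : Type} [NormedAddCommGroup F] [NormedSpace ℝ F] (h : R3 → F) (h' : R3 →L[ℝ] F),
      HasFDerivAt h h' ξ → HasDerivAt (fun s : ℝ => h (ξ + s • w)) (h' w) 0 := by
    intro F _ _ h h' hh
    have : HasFDerivAt h h' (ξ + (0 : ℝ) • w) := by rwa [h0]
    exact this.comp_hasDerivAt (0 : ℝ) hline
  have hr := key _ _ ((contDiff_damping c hτ (n := 1)).differentiable one_ne_zero ξ).hasFDerivAt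
  have ha := key _ _ (hasFDerivAt_inv_japaneseBracket ξ)
  have hN := key _ _ hY.norm_sq
  have hn := key _ _ ((hasFDerivAt_velocity ξ).inner ℝ hY)
  have hD := key _ _ ((contDiff_ibpDiv c hτ (n := 1)).differentiable one_ne_zero ξ).hasFDerivAt
  have hD' := ((hr.mul ((ha.const_mul 2).add (ha.pow 3))).sub
    ((((hr.pow 2).const_mul (2 * τ)).mul ha).mul (hN.sub (hn.pow 2))))
  have heq := hD.unique hD'
  rw [heq]
  have hwn := norm_ibpField c hτ ξ
  rw [← hw] at hwn
  have hv := norm_velocityDeriv_apply_le ξ w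
  have hp := norm_velocity_le_one ξ
  have ha1 : (japaneseBracket ξ)⁻¹ ≤ 1 := inv_le_one_of_one_le₀ (one_le_japaneseBracket ξ)
  have ha0 : 0 < (japaneseBracket ξ)⁻¹ := inv_pos.2 (japaneseBracket_pos ξ)
  have hrp := damping_pos c hτ ξ
  have hy := norm_nonneg (velocity ξ + c)
  have B := abs_ibpDiv_deriv_bound (τ := τ) (a := (japaneseBracket ξ)⁻¹) (r := damping τ c ξ)
    (y := ‖velocity ξ + c‖) (n := inner ℝ (velocity ξ) (velocity ξ + c))
    (a' := -(japaneseBracket ξ)⁻¹ ^ 2 * inner ℝ (velocity ξ) w)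
    (r' := fderiv ℝ (damping τ c) ξ w)
    (N' := 2 * inner ℝ (velocity ξ + c) (velocityDeriv ξ w))
    (n' := inner ℝ (velocity ξ) (velocityDeriv ξ w) + inner ℝ (velocityDeriv ξ w) (velocity ξ + c))
    hτ ha0.le ha1 hrp hy (mul_damping_mul_sq_le_one c hτ ξ)
    ((abs_real_inner_le_norm _ _).trans (mul_le_of_le_one_left hy hp))
    (by
      rw [abs_mul, abs_neg, abs_of_nonneg (by positivity), ← hwn]
      refine (mul_le_of_le_one_left (abs_nonneg _) (pow_le_one₀ ha0.le ha1)).trans ?_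
      exact (abs_real_inner_le_norm _ _).trans (mul_le_of_le_one_left (norm_nonneg _) hp))
    (abs_fderiv_damping_le c hτ ξ)
    (by
      rw [abs_mul, abs_two]
      have := abs_real_inner_le_norm (velocity ξ + c) (velocityDeriv ξ w)
      rw [hwn] at hv
      nlinarith)
    (by
      have h1 := abs_real_inner_le_norm (velocity ξ) (velocityDeriv ξ w)
      have h2 := abs_real_inner_le_norm (velocityDeriv ξ w) (velocity ξ + c)
      rw [hwn] at hv
      refine (abs_add_le _ _).trans ?_
      have h3 := norm_nonneg (velocityDeriv ξ w)
      nlinarith [mul_le_mul_of_nonneg_right hv hy])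
  refine le_trans (le_of_eq ?_) B
  congr 1
  simp [-inv_pow, -mul_eq_mul_left_iff, inner_add_left, inner_add_right]
  ring

end Field
end

/-! ### Integration by parts against the oscillating factor -/

noncomputable section

/-- The oscillating factor `exp (i t (⟨ξ⟩ + c · ξ))`. -/
def phaseExp (t : ℝ) (c ξ : R3) : ℂ :=
  Complex.exp (Complex.I * ((t * (japaneseBracket ξ + inner ℝ c ξ) : ℝ) : ℂ))

lemma norm_phaseExp (t : ℝ) (c ξ : R3) : ‖phaseExp t c ξ‖ = 1 := by
  rw [phaseExp, mul_comm, Complex.norm_exp_ofReal_mul_I]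

lemma contDiff_phaseExp (t : ℝ) (c : R3) {n : WithTop ℕ∞} : ContDiff ℝ n (phaseExp t c) := by
  unfold phaseExp
  have h : ContDiff ℝ n (fun ξ : R3 => t * (japaneseBracket ξ + inner ℝ c ξ)) :=
    contDiff_const.mul (contDiff_japaneseBracket.add (contDiff_const.inner ℝ contDiff_id))
  exact (contDiff_const.mul (Complex.ofRealCLM.contDiff.comp h)).cexp

lemma fderiv_phaseExp (t : ℝ) (c ξ w : R3) :
    fderiv ℝ (phaseExp t c) ξ w =
      Complex.I * ((t * inner ℝ (velocity ξ + c) w : ℝ) : ℂ) * phaseExp t c ξ := by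
  have h1 : HasFDerivAt (fun ξ : R3 => t * (japaneseBracket ξ + inner ℝ c ξ))
      (t • (innerSL ℝ (velocity ξ) + innerSL ℝ c)) ξ :=
    ((hasFDerivAt_japaneseBracket ξ).add (innerSL ℝ c).hasFDerivAt).const_mul t
  have h2 := ((Complex.ofRealCLM.hasFDerivAt.comp ξ h1).const_mul Complex.I).cexp
  have h3 : HasFDerivAt (phaseExp t c) _ ξ := h2
  rw [h3.fderiv]
  simp [phaseExp, inner_add_left]
  ring

variable {τ σ : ℝ} (c : R3)

/-- The transpose of the first-order operator that reproduces `phaseExp`. -/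
def ibpOp (τ σ : ℝ) (c : R3) (G : R3 → ℂ) (ξ : R3) : ℂ :=
  ((damping τ c ξ : ℂ) + Complex.I * σ * (ibpDiv τ c ξ : ℂ)) * G ξ +
    Complex.I * σ * fderiv ℝ G ξ (ibpField τ c ξ)

lemma contDiff_ibpOp (hτ : 0 ≤ τ) {G : R3 → ℂ} (hG : ContDiff ℝ 2 G) :
    ContDiff ℝ 1 (ibpOp τ σ c G) := by
  unfold ibpOp
  have h1 : ContDiff ℝ 1 (fun ξ => (damping τ c ξ : ℂ)) :=
    Complex.ofRealCLM.contDiff.comp (contDiff_damping c hτ)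
  have h2 : ContDiff ℝ 1 (fun ξ => (ibpDiv τ c ξ : ℂ)) :=
    Complex.ofRealCLM.contDiff.comp (contDiff_ibpDiv c hτ)
  have h3 : ContDiff ℝ 1 (fun ξ => fderiv ℝ G ξ (ibpField τ c ξ)) :=
    (hG.fderiv_right (m := 1) (by norm_num)).clm_apply (contDiff_ibpField c hτ)
  have h4 : ContDiff ℝ 1 G := hG.of_le (by norm_num)
  exact ((h1.add (contDiff_const.mul h2)).mul h4).add (contDiff_const.mul h3)

lemma hasCompactSupport_ibpOp {G : R3 → ℂ} (hG : HasCompactSupport G) :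
    HasCompactSupport (ibpOp τ σ c G) := by
  refine hG.mono' fun ξ hξ => ?_
  by_contra h
  apply hξ
  have h1 : G ξ = 0 := image_eq_zero_of_notMem_tsupport h
  have h2 : fderiv ℝ G ξ = 0 := by
    by_contra h'
    exact h (support_fderiv_subset ℝ h')
  simp [ibpOp, h1, h2]

lemma integral_phaseExp_mul_fderiv (t : ℝ) {h : R3 → ℂ} (hh : ContDiff ℝ 1 h)
    (hc : HasCompactSupport h) (v : R3) :
    ∫ ξ, phaseExp t c ξ * fderiv ℝ h ξ v = - ∫ ξ, fderiv ℝ (phaseExp t c) ξ v * h ξ := by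
  have hE : ContDiff ℝ 1 (phaseExp t c) := contDiff_phaseExp t c
  have hE' : Continuous (fun ξ => fderiv ℝ (phaseExp t c) ξ v) :=
    (hE.continuous_fderiv one_ne_zero).clm_apply continuous_const
  have hh' : Continuous (fun ξ => fderiv ℝ h ξ v) :=
    (hh.continuous_fderiv one_ne_zero).clm_apply continuous_const
  apply integral_mul_fderiv_eq_neg_fderiv_mul_of_integrable
  · exact (hE'.mul hh.continuous).integrable_of_hasCompactSupport hc.mul_left
  · exact (hE.continuous.mul hh').integrable_of_hasCompactSupport
      ((hc.fderiv_apply ℝ v).mul_left)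
  · exact (hE.continuous.mul hh.continuous).integrable_of_hasCompactSupport hc.mul_left
  · exact fun x _ => hE.differentiable one_ne_zero x
  · exact fun x _ => hh.differentiable one_ne_zero x

lemma sum_fderiv_ibpField_mul (hτ : 0 ≤ τ) {G : R3 → ℂ} (hG : ContDiff ℝ 1 G) (ξ : R3) :
    ∑ i : Fin 3, fderiv ℝ (fun x => ((ibpField τ c x i : ℝ) : ℂ) * G x) ξ
      (EuclideanSpace.single i 1) =
    (ibpDiv τ c ξ : ℂ) * G ξ + fderiv ℝ G ξ (ibpField τ c ξ) := by
  have hb : HasFDerivAt (ibpField τ c) (fderiv ℝ (ibpField τ c) ξ) ξ :=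
    ((contDiff_ibpField c hτ (n := 1)).differentiable one_ne_zero ξ).hasFDerivAt
  have hGd : HasFDerivAt G (fderiv ℝ G ξ) ξ := (hG.differentiable one_ne_zero ξ).hasFDerivAt
  have h1 : ∀ i : Fin 3, fderiv ℝ (fun x => ((ibpField τ c x i : ℝ) : ℂ) * G x) ξ
      (EuclideanSpace.single i 1) =
      ((fderiv ℝ (ibpField τ c) ξ (EuclideanSpace.single i 1) i : ℝ) : ℂ) * G ξ +
        (ibpField τ c ξ i) • fderiv ℝ G ξ (EuclideanSpace.single i 1) := by
    intro i
    have h2 : HasFDerivAt (fun x => ((ibpField τ c x i : ℝ) : ℂ))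
        (Complex.ofRealCLM.comp ((EuclideanSpace.proj i).comp (fderiv ℝ (ibpField τ c) ξ))) ξ :=
      Complex.ofRealCLM.hasFDerivAt.comp ξ
        ((EuclideanSpace.proj i : R3 →L[ℝ] ℝ).hasFDerivAt.comp ξ hb)
    have h3 := h2.mul hGd
    rw [show (fun x => ((ibpField τ c x i : ℝ) : ℂ) * G x) =
      (fun x => ((ibpField τ c x i : ℝ) : ℂ)) * G from rfl, h3.fderiv]
    simp
    ring
  rw [Finset.sum_congr rfl fun i _ => h1 i, Finset.sum_add_distrib, ← Finset.sum_mul,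
    ← sum_fderiv_ibpField c hτ ξ]
  congr 1
  · push_cast; rfl
  · rw [← Finset.sum_congr rfl fun i _ => map_smul (fderiv ℝ G ξ) _ _, ← map_sum]
    congr 1
    ext j
    fin_cases j <;> simp [Fin.sum_univ_three]

/-- Write `E` for the oscillating factor. Since `b · ∇E = i t r y² E` and `σ t = τ`, the operator `r
- i σ b · ∇` sends `E` to `r (1 + τ y²) E = E`. Moving it onto `G` gives `r G + i σ div (b G)`,
which is `ibpOp`; compact support removes the boundary terms. -/
lemma integral_phaseExp_mul_eq {t : ℝ} (hτ : 0 ≤ τ) (hσ : σ * t = τ) {G : R3 → ℂ}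
    (hG : ContDiff ℝ 1 G) (hc : HasCompactSupport G) :
    ∫ ξ, phaseExp t c ξ * G ξ = ∫ ξ, phaseExp t c ξ * ibpOp τ σ c G ξ := by
  have hE : ContDiff ℝ 1 (phaseExp t c) := contDiff_phaseExp t c
  have hbi : ∀ i : Fin 3, ContDiff ℝ 1 (fun x => ((ibpField τ c x i : ℝ) : ℂ) * G x) := fun i =>
    (Complex.ofRealCLM.contDiff.comp
      ((EuclideanSpace.proj i : R3 →L[ℝ] ℝ).contDiff.comp
        (contDiff_ibpField c hτ))).mul hG
  have hbc : ∀ i : Fin 3, HasCompactSupport (fun x => ((ibpField τ c x i : ℝ) : ℂ) * G x) :=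
    fun i => hc.mul_left
  have hint : ∀ i : Fin 3, Integrable (fun ξ => phaseExp t c ξ *
      fderiv ℝ (fun x => ((ibpField τ c x i : ℝ) : ℂ) * G x) ξ (EuclideanSpace.single i 1)) := by
    intro i
    exact (hE.continuous.mul (((hbi i).continuous_fderiv one_ne_zero).clm_apply
      continuous_const)).integrable_of_hasCompactSupport (((hbc i).fderiv_apply ℝ _).mul_left)
  have hint' : ∀ i : Fin 3, Integrable (fun ξ => fderiv ℝ (phaseExp t c) ξ
      (EuclideanSpace.single i 1) * (((ibpField τ c ξ i : ℝ) : ℂ) * G ξ)) := by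
    intro i
    exact (((hE.continuous_fderiv one_ne_zero).clm_apply continuous_const).mul
      (hbi i).continuous).integrable_of_hasCompactSupport (hbc i).mul_left
  have h1 : ∫ ξ, phaseExp t c ξ * ((ibpDiv τ c ξ : ℂ) * G ξ + fderiv ℝ G ξ (ibpField τ c ξ)) =
      - ∫ ξ, Complex.I * ((t * damping τ c ξ * ‖velocity ξ + c‖ ^ 2 : ℝ) : ℂ) *
        (phaseExp t c ξ * G ξ) := by
    calc _ = ∫ ξ, ∑ i : Fin 3, phaseExp t c ξ * fderiv ℝ
          (fun x => ((ibpField τ c x i : ℝ) : ℂ) * G x) ξ (EuclideanSpace.single i 1) := by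
          refine integral_congr_ae (Filter.Eventually.of_forall fun ξ => ?_)
          simp only
          rw [← sum_fderiv_ibpField_mul c hτ hG, Finset.mul_sum]
      _ = ∑ i : Fin 3, - ∫ ξ, fderiv ℝ (phaseExp t c) ξ (EuclideanSpace.single i 1) *
          (((ibpField τ c ξ i : ℝ) : ℂ) * G ξ) := by
          rw [integral_finsetSum _ fun i _ => hint i]
          exact Finset.sum_congr rfl fun i _ =>
            integral_phaseExp_mul_fderiv c t (hbi i) (hbc i) _
      _ = _ := by
          rw [Finset.sum_neg_distrib, ← integral_finsetSum _ fun i _ => hint' i]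
          congr 1
          refine integral_congr_ae (Filter.Eventually.of_forall fun ξ => ?_)
          simp only [fderiv_phaseExp, ibpField]
          rw [EuclideanSpace.norm_sq_eq]
          simp [Fin.sum_univ_three, EuclideanSpace.inner_single_right]
          ring
  have hGi : Integrable (fun ξ => phaseExp t c ξ * ((damping τ c ξ : ℂ) * G ξ)) :=
    (hE.continuous.mul ((Complex.continuous_ofReal.comp
      (contDiff_damping c hτ (n := 1)).continuous).mul hG.continuous)).integrable_of_hasCompactSupport
      hc.mul_left.mul_left
  have hDi : Integrable (fun ξ => phaseExp t c ξ *
      ((ibpDiv τ c ξ : ℂ) * G ξ + fderiv ℝ G ξ (ibpField τ c ξ))) := by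
    have := integrable_finsetSum (μ := volume) Finset.univ fun i (_ : i ∈ Finset.univ) => hint i
    refine this.congr (Filter.Eventually.of_forall fun ξ => ?_)
    simp only
    rw [← sum_fderiv_ibpField_mul c hτ hG, Finset.mul_sum]
  have hni : Integrable (fun ξ => Complex.I * ((t * damping τ c ξ * ‖velocity ξ + c‖ ^ 2 : ℝ) : ℂ) *
        (phaseExp t c ξ * G ξ)) := by
    have h1 : Continuous (damping τ c) := (contDiff_damping c hτ (n := 1)).continuous
    have h2 : Continuous velocity := (contDiff_velocity (n := 1)).continuous
    have h3 : Continuous (phaseExp t c) := hE.continuous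
    have h4 := hG.continuous
    exact Continuous.integrable_of_hasCompactSupport (by fun_prop) hc.mul_left.mul_left
  have h2 : ∫ ξ, phaseExp t c ξ * ibpOp τ σ c G ξ =
      (∫ ξ, phaseExp t c ξ * ((damping τ c ξ : ℂ) * G ξ)) + Complex.I * σ *
        ∫ ξ, phaseExp t c ξ * ((ibpDiv τ c ξ : ℂ) * G ξ + fderiv ℝ G ξ (ibpField τ c ξ)) := by
    rw [← integral_const_mul, ← integral_add hGi (hDi.const_mul _)]
    refine integral_congr_ae (Filter.Eventually.of_forall fun ξ => ?_)
    simp only [ibpOp]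
    ring
  rw [h2, h1, mul_neg, ← integral_const_mul, ← sub_eq_add_neg, ← integral_sub hGi (hni.const_mul _)]
  refine integral_congr_ae (Filter.Eventually.of_forall fun ξ => ?_)
  -- The definition of the damping is exactly what makes the operator reproduce the oscillating
  -- factor.
  have h3 : (damping τ c ξ : ℂ) * (1 + σ * t * ‖velocity ξ + c‖ ^ 2) = 1 := by
    have := damping_mul c hτ ξ
    rw [← hσ] at this ⊢
    exact_mod_cast this
  simp only
  push_cast
  linear_combination (-phaseExp t c ξ * G ξ) * h3 +
    (σ * t * damping τ c ξ * ‖velocity ξ + c‖ ^ 2 * phaseExp t c ξ * G ξ) * Complex.I_sq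

/-- Each derivative falling on `G` carries a factor `|b| = r y`, each undifferentiated coefficient
is at most `6 r`, and a coefficient differentiated along `b` is at most `48 (1 + y) r²`. Hence `84 =
6 · 6 + 48` in front of `G`, and `18 = 6 + 6 + 6` in front of its gradient, the last `6` coming from
the derivative of `b` along itself. -/
lemma norm_ibpOp_ibpOp_le (hτ : 0 ≤ τ) (hσ : |σ| = 1) {G : R3 → ℂ} (hG : ContDiff ℝ 2 G) (ξ : R3) :
    ‖ibpOp τ σ c (ibpOp τ σ c G) ξ‖ ≤
      84 * ((1 + ‖velocity ξ + c‖) * damping τ c ξ ^ 2 * ‖G ξ‖) +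
      18 * (‖velocity ξ + c‖ * damping τ c ξ ^ 2 * ‖fderiv ℝ G ξ‖) +
      ‖velocity ξ + c‖ ^ 2 * damping τ c ξ ^ 2 * ‖fderiv ℝ (fderiv ℝ G) ξ‖ := by
  set b := ibpField τ c ξ with hb
  set r := damping τ c ξ with hr
  set y := ‖velocity ξ + c‖ with hy
  have hr0 : 0 < r := damping_pos c hτ ξ
  have hy0 : 0 ≤ y := norm_nonneg _
  have hbn : ‖b‖ = r * y := norm_ibpField c hτ ξ
  set dd : R3 → ℂ := fun ξ => (damping τ c ξ : ℂ) + Complex.I * σ * (ibpDiv τ c ξ : ℂ) with hdd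
  have hσc : ‖Complex.I * (σ : ℂ)‖ = 1 := by simp [hσ]
  have hd : ‖dd ξ‖ ≤ 6 * r := by
    refine (norm_add_le _ _).trans ?_
    rw [norm_mul, hσc, Complex.norm_real, Complex.norm_real, Real.norm_of_nonneg hr0.le,
      Real.norm_eq_abs]
    linarith [abs_ibpDiv_le c hτ ξ]
  have hrd : HasFDerivAt (damping τ c) (fderiv ℝ (damping τ c) ξ) ξ :=
    ((contDiff_damping c hτ (n := 1)).differentiable one_ne_zero ξ).hasFDerivAt
  have hDd : HasFDerivAt (ibpDiv τ c) (fderiv ℝ (ibpDiv τ c) ξ) ξ :=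
    ((contDiff_ibpDiv c hτ (n := 1)).differentiable one_ne_zero ξ).hasFDerivAt
  have hbd : HasFDerivAt (ibpField τ c) (fderiv ℝ (ibpField τ c) ξ) ξ :=
    ((contDiff_ibpField c hτ (n := 1)).differentiable one_ne_zero ξ).hasFDerivAt
  have hGd : HasFDerivAt G (fderiv ℝ G ξ) ξ :=
    (hG.differentiable two_ne_zero ξ).hasFDerivAt
  have hGdd : HasFDerivAt (fderiv ℝ G) (fderiv ℝ (fderiv ℝ G) ξ) ξ :=
    ((hG.fderiv_right (m := 1) (by norm_num)).differentiable one_ne_zero ξ).hasFDerivAt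
  have hddd : HasFDerivAt dd (Complex.ofRealCLM.comp (fderiv ℝ (damping τ c) ξ) +
      (Complex.I * σ) • Complex.ofRealCLM.comp (fderiv ℝ (ibpDiv τ c) ξ)) ξ :=
    (Complex.ofRealCLM.hasFDerivAt.comp ξ hrd).add
      ((Complex.ofRealCLM.hasFDerivAt.comp ξ hDd).const_mul (Complex.I * (σ : ℂ)))
  have hop : HasFDerivAt (ibpOp τ σ c G) _ ξ :=
    (hddd.mul hGd).add ((hGdd.clm_apply hbd).const_mul (Complex.I * (σ : ℂ)))
  have e1 : ibpOp τ σ c (ibpOp τ σ c G) ξ =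
      dd ξ * (dd ξ * G ξ + Complex.I * σ * fderiv ℝ G ξ b) +
        Complex.I * σ * (dd ξ * fderiv ℝ G ξ b + ((fderiv ℝ (damping τ c) ξ b : ℂ) +
          Complex.I * σ * (fderiv ℝ (ibpDiv τ c) ξ b : ℂ)) * G ξ +
          Complex.I * σ * (fderiv ℝ (fderiv ℝ G) ξ b b +
            fderiv ℝ G ξ (fderiv ℝ (ibpField τ c) ξ b))) := by
    rw [ibpOp, hop.fderiv]
    simp only [ibpOp, hdd, ← hb]
    simp [-mul_eq_mul_left_iff]
    ring
  have n1 : ‖fderiv ℝ G ξ b‖ ≤ r * y * ‖fderiv ℝ G ξ‖ := by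
    rw [← hbn, mul_comm]; exact (fderiv ℝ G ξ).le_opNorm b
  have n2 : ‖fderiv ℝ (fderiv ℝ G) ξ b b‖ ≤ (r * y) * (r * y) * ‖fderiv ℝ (fderiv ℝ G) ξ‖ := by
    have := (fderiv ℝ (fderiv ℝ G) ξ).le_opNorm₂ b b
    rw [hbn] at this
    linarith
  have n3 : ‖fderiv ℝ G ξ (fderiv ℝ (ibpField τ c) ξ b)‖ ≤ 6 * r ^ 2 * y * ‖fderiv ℝ G ξ‖ := by
    refine ((fderiv ℝ G ξ).le_opNorm _).trans ?_
    rw [mul_comm]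
    exact mul_le_mul_of_nonneg_right (norm_fderiv_ibpField_le c hτ ξ) (norm_nonneg _)
  have n4 : ‖(fderiv ℝ (damping τ c) ξ b : ℂ) + Complex.I * σ * (fderiv ℝ (ibpDiv τ c) ξ b : ℂ)‖ ≤
      48 * (1 + y) * r ^ 2 := by
    refine (norm_add_le _ _).trans ?_
    rw [norm_mul, hσc, Complex.norm_real, Complex.norm_real, Real.norm_eq_abs, Real.norm_eq_abs]
    have h1 := abs_fderiv_damping_le c hτ ξ
    have h2 := abs_fderiv_ibpDiv_le c hτ ξ
    rw [← hb, ← hr] at h1 h2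
    rw [← hy] at h2
    nlinarith [mul_nonneg hy0 (sq_nonneg r)]
  have hG0 := norm_nonneg (G ξ)
  have hG1 := norm_nonneg (fderiv ℝ G ξ)
  rw [e1]
  calc _ ≤ ‖dd ξ‖ * (‖dd ξ‖ * ‖G ξ‖ + ‖fderiv ℝ G ξ b‖) + (‖dd ξ‖ * ‖fderiv ℝ G ξ b‖ +
        ‖(fderiv ℝ (damping τ c) ξ b : ℂ) + Complex.I * σ * (fderiv ℝ (ibpDiv τ c) ξ b : ℂ)‖ * ‖G ξ‖ +
          (‖fderiv ℝ (fderiv ℝ G) ξ b b‖ + ‖fderiv ℝ G ξ (fderiv ℝ (ibpField τ c) ξ b)‖)) := by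
        have tri : ∀ u v z : ℂ, ‖u * v + z‖ ≤ ‖u‖ * ‖v‖ + ‖z‖ := fun u v z =>
          (norm_add_le _ _).trans_eq (by rw [norm_mul])
        have one : ∀ u : ℂ, ‖Complex.I * σ * u‖ = ‖u‖ := fun u => by rw [norm_mul, hσc, one_mul]
        refine (tri _ _ _).trans ?_
        rw [one]
        gcongr
        · refine (tri _ _ _).trans ?_
          rw [one]
        · refine (norm_add_le _ _).trans ?_
          rw [one]
          gcongr
          · refine (tri _ _ _).trans ?_
            rw [norm_mul]
          · exact norm_add_le _ _
    _ ≤ 6 * r * (6 * r * ‖G ξ‖ + r * y * ‖fderiv ℝ G ξ‖) + (6 * r * (r * y * ‖fderiv ℝ G ξ‖) +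
        48 * (1 + y) * r ^ 2 * ‖G ξ‖ + ((r * y) * (r * y) * ‖fderiv ℝ (fderiv ℝ G) ξ‖ +
          6 * r ^ 2 * y * ‖fderiv ℝ G ξ‖)) := by gcongr
    _ ≤ _ := by nlinarith [mul_nonneg (mul_nonneg hy0 (sq_nonneg r)) hG0]

end

/-! ### The change of variables to velocity -/

noncomputable section

/-- With `a = ⟨ξ⟩⁻¹`, the eigenvalues of `a (1 - p ⊗ p)` are `a` twice, across `p`, and `a (1 -
|p|²) = a³` along `p`. -/
lemma det_velocityDeriv (ξ : R3) : (velocityDeriv ξ).det = (japaneseBracket ξ)⁻¹ ^ 5 := by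
  have hp := norm_velocity_sq ξ
  rw [EuclideanSpace.norm_sq_eq] at hp
  simp only [Fin.sum_univ_three, Real.norm_eq_abs, sq_abs] at hp
  rw [ContinuousLinearMap.det,
    ← LinearMap.det_toMatrix (EuclideanSpace.basisFun (Fin 3) ℝ).toBasis, Matrix.det_fin_three]
  simp only [LinearMap.toMatrix_apply, OrthonormalBasis.coe_toBasis, EuclideanSpace.basisFun_apply,
    ContinuousLinearMap.coe_coe, velocityDeriv_apply, OrthonormalBasis.coe_toBasis_repr_apply,
    EuclideanSpace.basisFun_repr]
  simp [-inv_pow, EuclideanSpace.inner_single_right]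
  generalize (japaneseBracket ξ)⁻¹ = a at *
  generalize velocity ξ = p at *
  linear_combination (-a ^ 3) * hp

/-- The length of the velocity determines `⟨ξ⟩`, and then the velocity determines `ξ`. -/
lemma velocity_injective : Function.Injective velocity := by
  intro ξ η h
  have h1 := norm_velocity_sq ξ
  rw [h, norm_velocity_sq η] at h1
  have h2 : (japaneseBracket η)⁻¹ = (japaneseBracket ξ)⁻¹ := by
    have := inv_pos.2 (japaneseBracket_pos ξ)
    have := inv_pos.2 (japaneseBracket_pos η)
    nlinarith
  rw [velocity, velocity, h2] at h
  exact smul_right_injective R3 (inv_pos.2 (japaneseBracket_pos ξ)).ne' h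

lemma lintegral_velocity_le (g : R3 → ℝ≥0∞) :
    ∫⁻ ξ, ENNReal.ofReal ((japaneseBracket ξ)⁻¹ ^ 5) * g (velocity ξ) ≤ ∫⁻ p, g p := by
  have h := lintegral_image_eq_lintegral_abs_det_fderiv_mul (μ := (volume : Measure R3))
    MeasurableSet.univ (fun x _ => (hasFDerivAt_velocity x).hasFDerivWithinAt)
    velocity_injective.injOn g
  rw [Measure.restrict_univ] at h
  refine le_trans (le_of_eq ?_) (h.symm.le.trans (setLIntegral_le_lintegral _ _))
  congr 1
  ext ξ
  rw [det_velocityDeriv, abs_of_nonneg (pow_nonneg (inv_pos.2 (japaneseBracket_pos ξ)).le 5)]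

lemma lintegral_comp_smul_R3 {g : R3 → ℝ≥0∞} (hg : Measurable g) {s : ℝ} (hs : 0 < s) :
    ∫⁻ p : R3, g (s • p) = ENNReal.ofReal ((s ^ 3)⁻¹) * ∫⁻ p, g p := by
  have h := Measure.map_addHaar_smul (volume : Measure R3) hs.ne'
  rw [finrank_euclideanSpace_fin, abs_of_pos (by positivity)] at h
  rw [← lintegral_map hg (measurable_const_smul s), h, lintegral_smul_measure, smul_eq_mul]

/-- In the velocity variable, translating by `c` and rescaling by `√τ` turn the damping into `(1 +
|p|²)⁻¹` and produce `τ^(-3/2)`. Its power `9/5` is integrable in dimension three because `18/5 >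
3`. This exponent is the one needed later: `9/5 = (3/2) (6/5)` for the gradient term, and `9/5 ≤ 2`
for the others. -/
lemma lintegral_damping_le : ∃ C : ℝ≥0, ∀ (τ : ℝ) (c : R3), 0 < τ →
    ∫⁻ ξ, ENNReal.ofReal ((japaneseBracket ξ)⁻¹ ^ 5) *
      ENNReal.ofReal (damping τ c ξ ^ (9 / 5 : ℝ)) ≤ C * ENNReal.ofReal (τ ^ (-(3 / 2) : ℝ)) := by
  set h : R3 → ℝ≥0∞ := fun p => ENNReal.ofReal ((1 + ‖p‖ ^ 2) ^ (-(18 / 5) / 2 : ℝ)) with hh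
  have hm : Measurable h := by rw [hh]; fun_prop
  have hi : Integrable (fun p : R3 => (1 + ‖p‖ ^ 2) ^ (-(18 / 5) / 2 : ℝ)) :=
    integrable_rpow_neg_one_add_norm_sq (by rw [finrank_euclideanSpace_fin]; norm_num)
  have hfin : ∫⁻ p, h p ≠ ∞ := hi.lintegral_lt_top.ne
  refine ⟨(∫⁻ p, h p).toNNReal, fun τ c hτ => ?_⟩
  rw [ENNReal.coe_toNNReal hfin]
  have hs : 0 < Real.sqrt τ := Real.sqrt_pos.2 hτ
  calc _ = ∫⁻ ξ, ENNReal.ofReal ((japaneseBracket ξ)⁻¹ ^ 5) *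
        (fun p => h (Real.sqrt τ • (p + c))) (velocity ξ) := by
        congr 1
        ext ξ
        congr 2
        simp only [damping]
        rw [norm_smul, mul_pow, Real.norm_of_nonneg hs.le, Real.sq_sqrt hτ.le,
          Real.inv_rpow (by positivity), ← Real.rpow_neg (by positivity)]
        norm_num
    _ ≤ ∫⁻ p, h (Real.sqrt τ • (p + c)) := lintegral_velocity_le _
    _ = ∫⁻ p, h (Real.sqrt τ • p) :=
        lintegral_add_right_eq_self (fun p => h (Real.sqrt τ • p)) c
    _ = ENNReal.ofReal ((Real.sqrt τ ^ 3)⁻¹) * ∫⁻ p, h p := lintegral_comp_smul_R3 hm hs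
    _ = _ := by
        rw [mul_comm]
        congr 2
        rw [Real.sqrt_eq_rpow, ← Real.rpow_natCast, ← Real.rpow_mul hτ.le, ← Real.rpow_neg hτ.le]
        norm_num

end

/-! ### Weighted integrals and the estimate for compactly supported amplitudes -/

noncomputable section

variable {τ : ℝ} (c : R3)

/-- The vector `c = x / t` is arbitrary, so `y` may be large. For `y ≤ 3` the factor `1 + y` is
harmless. For larger `y` the phase is far from stationary: `r² y⁴ ≤ τ⁻²` absorbs `1 + y ≤ 2 y⁴`. -/
lemma one_add_mul_damping_sq_le (hτ : 0 < τ) (ξ : R3) :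
    (1 + ‖velocity ξ + c‖) * damping τ c ξ ^ 2 ≤
      4 * damping τ c ξ ^ (9 / 5 : ℝ) + 2 * (τ ^ 2)⁻¹ := by
  have hr := damping_pos c hτ.le ξ
  have hr1 := damping_le_one c hτ.le ξ
  have hu := mul_damping_mul_sq_le_one c hτ.le ξ
  have hy := norm_nonneg (velocity ξ + c)
  have h1 : damping τ c ξ ^ 2 ≤ damping τ c ξ ^ (9 / 5 : ℝ) := by
    rw [← Real.rpow_natCast]
    exact Real.rpow_le_rpow_of_exponent_ge hr hr1 (by norm_num)
  have h0 : 0 ≤ damping τ c ξ ^ (9 / 5 : ℝ) := by positivity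
  generalize ‖velocity ξ + c‖ = y at *
  generalize damping τ c ξ ^ (9 / 5 : ℝ) = z at *
  generalize damping τ c ξ = r at *
  have h3 : 0 < (τ ^ 2)⁻¹ := by positivity
  rcases le_total y 3 with h | h
  · nlinarith [sq_nonneg r]
  · have h4 : (τ * r * y ^ 2) ^ 2 ≤ 1 := pow_le_one₀ (by positivity) hu
    have h5 : r ^ 2 * y ^ 4 ≤ (τ ^ 2)⁻¹ := by
      rw [← one_div, le_div_iff₀ (by positivity)]
      nlinarith
    have h6 : 1 + y ≤ 2 * y ^ 4 := by
      have : y ≤ y ^ 4 := le_self_pow₀ (by linarith) (by norm_num)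
      linarith
    nlinarith [mul_le_mul_of_nonneg_right h6 (sq_nonneg r)]

lemma norm_sq_mul_damping_sq_le (hτ : 0 < τ) (ξ : R3) :
    ‖velocity ξ + c‖ ^ 2 * damping τ c ξ ^ 2 ≤ τ ^ (-1 : ℝ) * damping τ c ξ ^ (1 : ℝ) := by
  have hr := damping_pos c hτ.le ξ
  have hu := mul_damping_mul_sq_le_one c hτ.le ξ
  rw [Real.rpow_neg_one, Real.rpow_one, ← div_eq_inv_mul, le_div_iff₀ hτ]
  nlinarith [mul_le_mul_of_nonneg_right hu hr.le]

lemma norm_mul_damping_sq_le (hτ : 0 < τ) (ξ : R3) :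
    ‖velocity ξ + c‖ * damping τ c ξ ^ 2 ≤
      τ ^ (-(1 / 2) : ℝ) * damping τ c ξ ^ (3 / 2 : ℝ) := by
  have hr := damping_pos c hτ.le ξ
  have hu := mul_damping_mul_sq_le_one c hτ.le ξ
  have hy := norm_nonneg (velocity ξ + c)
  generalize ‖velocity ξ + c‖ = y at *
  generalize damping τ c ξ = r at *
  have h1 : τ ^ (-(1 / 2) : ℝ) = (Real.sqrt τ)⁻¹ := by
    rw [Real.rpow_neg hτ.le, ← Real.sqrt_eq_rpow]
  have h2 : r ^ (3 / 2 : ℝ) = r * Real.sqrt r := by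
    rw [Real.sqrt_eq_rpow]
    nth_rewrite 2 [← Real.rpow_one r]
    rw [← Real.rpow_add hr]; norm_num
  have hs := Real.sqrt_pos.2 hτ
  have hsr := Real.sqrt_pos.2 hr
  rw [h1, h2, ← div_eq_inv_mul, le_div_iff₀ hs]
  have h3 : Real.sqrt τ * Real.sqrt r * y ≤ 1 := by
    rw [← abs_of_nonneg (by positivity : 0 ≤ Real.sqrt τ * Real.sqrt r * y), ← sq_le_one_iff_abs_le_one]
    rw [mul_pow, mul_pow, Real.sq_sqrt hτ.le, Real.sq_sqrt hr.le]
    exact hu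
  calc y * r ^ 2 * Real.sqrt τ = (Real.sqrt τ * Real.sqrt r * y) * (r * Real.sqrt r) := by
        linear_combination (-(Real.sqrt τ * y * r)) * Real.mul_self_sqrt hr.le
    _ ≤ 1 * (r * Real.sqrt r) := by gcongr
    _ = _ := one_mul _

lemma japaneseBracket_le_one_add_norm (ξ : R3) : japaneseBracket ξ ≤ 1 + ‖ξ‖ :=
  sqrt_one_add_norm_sq_le ξ

/-- Hölder puts `m` in `L^q`, where `m^q` is at most `τ^(-α q) r^(9/5)` because `r ≤ 1` and `β q ≥
9/5`. The velocity integral then contributes `τ^(-3/(2q))`. -/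
lemma lintegral_mul_le_of_le_damping {C : ℝ≥0}
    (hC : ∀ (τ : ℝ) (c : R3), 0 < τ → ∫⁻ ξ, ENNReal.ofReal ((japaneseBracket ξ)⁻¹ ^ 5) *
      ENNReal.ofReal (damping τ c ξ ^ (9 / 5 : ℝ)) ≤ C * ENNReal.ofReal (τ ^ (-(3 / 2) : ℝ)))
    (hτ : 0 < τ) {K : ℝ} (hK : 1 ≤ K) {p q α β : ℝ} (hpq : p.HolderConjugate q) (hβ : 9 / 5 ≤ β * q)
    {m : R3 → ℝ} (hm : Continuous m) (hm0 : ∀ ξ, 0 ≤ m ξ)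
    (hmle : ∀ ξ, m ξ ≤ τ ^ (-α) * damping τ c ξ ^ β)
    {h : R3 → ℝ≥0∞} (hh : AEMeasurable h) (hsupp : ∀ ξ, 2 * K < ‖ξ‖ → h ξ = 0) :
    ∫⁻ ξ, ENNReal.ofReal (m ξ) * h ξ ≤
      (C * ENNReal.ofReal ((3 * K) ^ 5)) ^ (1 / q) *
        ENNReal.ofReal (τ ^ (-(α + 3 / (2 * q)))) * (∫⁻ ξ, h ξ ^ p) ^ (1 / p) := by
  have hq := hpq.symm.pos
  set S : Set R3 := {ξ | ‖ξ‖ ≤ 2 * K} with hS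
  have hSm : MeasurableSet S := measurableSet_le measurable_norm measurable_const
  have e : ∀ ξ, ENNReal.ofReal (m ξ) * h ξ = S.indicator (fun ξ => ENNReal.ofReal (m ξ)) ξ * h ξ := by
    intro ξ
    by_cases hξ : ξ ∈ S
    · rw [Set.indicator_of_mem hξ]
    · rw [hsupp ξ (not_le.1 hξ), mul_zero, mul_zero]
  rw [lintegral_congr e]
  have hmeas : Measurable (fun ξ => ENNReal.ofReal (m ξ)) := hm.measurable.ennreal_ofReal
  refine (ENNReal.lintegral_mul_le_Lp_mul_Lq volume hpq.symm
    (hmeas.indicator hSm).aemeasurable hh).trans ?_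
  refine mul_le_mul_left ?_ _
  have h1 : ∫⁻ ξ, S.indicator (fun ξ => ENNReal.ofReal (m ξ)) ξ ^ q ≤
      ENNReal.ofReal (τ ^ (-(α * q))) * ENNReal.ofReal ((3 * K) ^ 5) *
        (C * ENNReal.ofReal (τ ^ (-(3 / 2) : ℝ))) := by
    refine le_trans ?_ (mul_le_mul_right (hC τ c hτ) _)
    rw [← lintegral_const_mul' _ _ (by finiteness)]
    refine lintegral_mono fun ξ => ?_
    by_cases hξ : ξ ∈ S
    · rw [Set.indicator_of_mem hξ, ENNReal.ofReal_rpow_of_nonneg (hm0 ξ) hq.le,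
        ← ENNReal.ofReal_mul (by positivity),
        ← ENNReal.ofReal_mul (pow_nonneg (inv_pos.2 (japaneseBracket_pos ξ)).le 5),
        ← ENNReal.ofReal_mul (by positivity)]
      refine ENNReal.ofReal_le_ofReal ?_
      have hr := damping_pos c hτ.le ξ
      have hJ : japaneseBracket ξ ≤ 3 * K :=
        (japaneseBracket_le_one_add_norm ξ).trans (by have : ‖ξ‖ ≤ 2 * K := hξ; linarith)
      have hJ0 := japaneseBracket_pos ξ
      -- Nothing here decays in `ξ`, so the Jacobian weight is inserted by hand. On the support `⟨ξ⟩
      -- ≤ 1 + 2K ≤ 3K`, and the price is `(3K)⁵`.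
      have h2 : 1 ≤ (3 * K) ^ 5 * (japaneseBracket ξ)⁻¹ ^ 5 := by
        rw [← mul_pow]
        refine one_le_pow₀ ?_
        rw [← div_eq_mul_inv, le_div_iff₀ hJ0]
        linarith
      have h3 : m ξ ^ q ≤ τ ^ (-(α * q)) * damping τ c ξ ^ (9 / 5 : ℝ) := by
        calc m ξ ^ q ≤ (τ ^ (-α) * damping τ c ξ ^ β) ^ q :=
              Real.rpow_le_rpow (hm0 ξ) (hmle ξ) hq.le
          _ = τ ^ (-(α * q)) * damping τ c ξ ^ (β * q) := by
              rw [Real.mul_rpow (by positivity) (by positivity), ← Real.rpow_mul hτ.le,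
                ← Real.rpow_mul hr.le, neg_mul]
          _ ≤ _ := by
              refine mul_le_mul_of_nonneg_left ?_ (by positivity)
              exact Real.rpow_le_rpow_of_exponent_ge hr (damping_le_one c hτ.le ξ) hβ
      calc m ξ ^ q ≤ τ ^ (-(α * q)) * damping τ c ξ ^ (9 / 5 : ℝ) * 1 := by rw [mul_one]; exact h3
        _ ≤ τ ^ (-(α * q)) * damping τ c ξ ^ (9 / 5 : ℝ) *
            ((3 * K) ^ 5 * (japaneseBracket ξ)⁻¹ ^ 5) := by gcongr
        _ = _ := by ring
    · rw [Set.indicator_of_notMem hξ, ENNReal.zero_rpow_of_pos hq]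
      exact zero_le
  refine (ENNReal.rpow_le_rpow h1 (by positivity : 0 ≤ 1 / q)).trans (le_of_eq ?_)
  rw [show ENNReal.ofReal (τ ^ (-(α * q))) * ENNReal.ofReal ((3 * K) ^ 5) *
        (C * ENNReal.ofReal (τ ^ (-(3 / 2) : ℝ))) = (C * ENNReal.ofReal ((3 * K) ^ 5)) *
        (ENNReal.ofReal (τ ^ (-(α * q))) * ENNReal.ofReal (τ ^ (-(3 / 2) : ℝ))) by ring,
    ENNReal.mul_rpow_of_nonneg _ _ (by positivity : 0 ≤ 1 / q),
    ← ENNReal.ofReal_mul (by positivity), ← Real.rpow_add hτ,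
    ENNReal.ofReal_rpow_of_nonneg (by positivity) (by positivity), ← Real.rpow_mul hτ.le]
  congr 3
  field_simp
  ring

lemma integrable_one_add_norm_pow_six :
    Integrable (fun ξ : R3 => ((1 + ‖ξ‖) ^ 6)⁻¹) := by
  have := integrable_one_add_norm (E := R3) (μ := volume) (r := 6)
    (by rw [finrank_euclideanSpace_fin]; norm_num)
  refine this.congr (Filter.Eventually.of_forall fun ξ => ?_)
  simp only
  rw [Real.rpow_neg (by positivity)]
  norm_cast

/-- Here the weight of the sup norm supplies the Jacobian, as `(1 + |ξ|)⁻⁶ ≤ ⟨ξ⟩⁻⁵`, so there is no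
loss in frequency. The non-stationary remainder `τ⁻²` is at most `τ^(-3/2)` and is integrated
against the same weight. -/
lemma lintegral_one_add_mul_damping_sq_mul_le : ∃ C : ℝ≥0, ∀ (τ : ℝ) (c : R3) (A : ℝ≥0∞)
    (G : R3 → ℂ), 1 ≤ τ → (∀ᵐ ξ, ‖G ξ‖ₑ ≤ A * ENNReal.ofReal (((1 + ‖ξ‖) ^ 6)⁻¹)) →
    ∫⁻ ξ, ENNReal.ofReal ((1 + ‖velocity ξ + c‖) * damping τ c ξ ^ 2) * ‖G ξ‖ₑ ≤
      C * (A * ENNReal.ofReal (τ ^ (-(3 / 2) : ℝ))) := by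
  obtain ⟨C, hC⟩ := lintegral_damping_le
  have hfin := integrable_one_add_norm_pow_six.lintegral_lt_top.ne
  set I := ∫⁻ ξ : R3, ENNReal.ofReal (((1 + ‖ξ‖) ^ 6)⁻¹) with hI
  refine ⟨4 * C + 2 * I.toNNReal, fun τ c A G hτ hG => ?_⟩
  have hτ0 : 0 < τ := by linarith
  calc _ ≤ ∫⁻ ξ, A * (4 * (ENNReal.ofReal ((japaneseBracket ξ)⁻¹ ^ 5) *
        ENNReal.ofReal (damping τ c ξ ^ (9 / 5 : ℝ))) +
          2 * ENNReal.ofReal (τ ^ (-(3 / 2) : ℝ)) * ENNReal.ofReal (((1 + ‖ξ‖) ^ 6)⁻¹)) := by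
        refine lintegral_mono_ae ?_
        filter_upwards [hG] with ξ hξ
        refine (mul_le_mul_right hξ _).trans ?_
        rw [mul_left_comm]
        refine mul_le_mul_right ?_ _
        have hJ0 := japaneseBracket_pos ξ
        have hr := damping_pos c hτ0.le ξ
        have hJ := japaneseBracket_le_one_add_norm ξ
        have h1 : ((1 + ‖ξ‖) ^ 6)⁻¹ ≤ (japaneseBracket ξ)⁻¹ ^ 5 := by
          rw [inv_pow]
          apply inv_anti₀ (by positivity)
          calc japaneseBracket ξ ^ 5 ≤ (1 + ‖ξ‖) ^ 5 := by gcongr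
            _ ≤ (1 + ‖ξ‖) ^ 6 := pow_le_pow_right₀ (by linarith [norm_nonneg ξ]) (by norm_num)
        have h2 : (τ ^ 2)⁻¹ ≤ τ ^ (-(3 / 2) : ℝ) := by
          rw [← Real.rpow_natCast, ← Real.rpow_neg hτ0.le]
          exact Real.rpow_le_rpow_of_exponent_le hτ (by norm_num)
        rw [← ENNReal.ofReal_mul (by positivity)]
        refine (ENNReal.ofReal_le_ofReal (q := 4 * ((japaneseBracket ξ)⁻¹ ^ 5 *
          damping τ c ξ ^ (9 / 5 : ℝ)) + 2 * τ ^ (-(3 / 2) : ℝ) * ((1 + ‖ξ‖) ^ 6)⁻¹) ?_).trans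
          (le_of_eq ?_)
        swap
        · rw [ENNReal.ofReal_add (by positivity) (by positivity), ENNReal.ofReal_mul (by norm_num),
            ENNReal.ofReal_mul (by positivity), ENNReal.ofReal_mul (by positivity),
            ENNReal.ofReal_mul (p := 2) (by norm_num), ENNReal.ofReal_ofNat, ENNReal.ofReal_ofNat]
        calc _ ≤ (4 * damping τ c ξ ^ (9 / 5 : ℝ) + 2 * (τ ^ 2)⁻¹) * ((1 + ‖ξ‖) ^ 6)⁻¹ := by
              gcongr
              exact one_add_mul_damping_sq_le c hτ0 ξ
          _ = 4 * (((1 + ‖ξ‖) ^ 6)⁻¹ * damping τ c ξ ^ (9 / 5 : ℝ)) +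
              2 * (τ ^ 2)⁻¹ * ((1 + ‖ξ‖) ^ 6)⁻¹ := by ring
          _ ≤ _ := by gcongr
    _ ≤ A * (4 * (C * ENNReal.ofReal (τ ^ (-(3 / 2) : ℝ))) +
        2 * ENNReal.ofReal (τ ^ (-(3 / 2) : ℝ)) * I) := by
        have hm1 : Measurable (fun ξ => ENNReal.ofReal ((japaneseBracket ξ)⁻¹ ^ 5) *
            ENNReal.ofReal (damping τ c ξ ^ (9 / 5 : ℝ))) := by
          have h1 : Measurable japaneseBracket :=
            (contDiff_japaneseBracket (n := 0)).continuous.measurable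
          have h2 : Measurable (damping τ c) :=
            (contDiff_damping c hτ0.le (n := 0)).continuous.measurable
          fun_prop
        have hm2 : Measurable (fun ξ : R3 => ENNReal.ofReal (((1 + ‖ξ‖) ^ 6)⁻¹)) := by fun_prop
        rw [lintegral_const_mul _ (by fun_prop), lintegral_add_left (by fun_prop),
          lintegral_const_mul _ hm1, lintegral_const_mul _ hm2]
        gcongr
        exact hC τ c hτ0
    _ = _ := by
        push_cast
        rw [ENNReal.coe_toNNReal hfin]
        ring

/-- Sobolev embedding in dimension three, `1/6 = 1/2 - 1/3`, applied to the gradient. It allows the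
gradient term to be bounded by second derivatives alone. -/
lemma eLpNorm_fderiv_six_le : ∃ C : ℝ≥0, ∀ G : R3 → ℂ, ContDiff ℝ 2 G → HasCompactSupport G →
    eLpNorm (fderiv ℝ G) 6 volume ≤ C * eLpNorm (fderiv ℝ (fderiv ℝ G)) 2 volume := by
  refine ⟨SNormLESNormFDerivOfEqConst (R3 →L[ℝ] ℂ) (volume : Measure R3) 2, fun G hG hc => ?_⟩
  have := eLpNorm_le_eLpNorm_fderiv_of_eq (volume : Measure R3)
    (hG.fderiv_right (m := 1) (by norm_num)) (hc.fderiv ℝ) (p := 2) (p' := 6) (by norm_num)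
    (by rw [finrank_euclideanSpace_fin]; norm_num)
    (by rw [finrank_euclideanSpace_fin]; norm_num)
  exact_mod_cast this

/-- Dispersive estimate for compactly supported amplitudes: the leading term only involves a
weighted sup norm of the amplitude. -/
theorem enorm_integral_phaseExp_mul_le : ∃ C : ℝ≥0, ∀ (t : ℝ) (c : R3) (K : ℝ) (A : ℝ≥0∞)
    (G : R3 → ℂ), 1 ≤ |t| → 1 ≤ K → ContDiff ℝ 2 G → tsupport G ⊆ Metric.closedBall 0 (2 * K) →
    (∀ᵐ ξ, ‖G ξ‖ₑ ≤ A * ENNReal.ofReal (((1 + ‖ξ‖) ^ 6)⁻¹)) →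
    ‖∫ ξ, phaseExp t c ξ * G ξ‖ₑ ≤ C * (A * ENNReal.ofReal (|t| ^ (-(3 / 2) : ℝ)) +
      ENNReal.ofReal (K ^ (25 / 6 : ℝ) * |t| ^ (-(7 / 4) : ℝ)) *
        eLpNorm (fderiv ℝ (fderiv ℝ G)) 2 volume) := by
  obtain ⟨C₀, hC₀⟩ := lintegral_damping_le
  obtain ⟨C₁, hC₁⟩ := lintegral_one_add_mul_damping_sq_mul_le
  obtain ⟨C₂, hC₂⟩ := eLpNorm_fderiv_six_le
  set D : ℝ≥0 := C₀ * 243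
  refine ⟨84 * C₁ + (18 * D ^ (5 / 6 : ℝ) * C₂ + D ^ (1 / 2 : ℝ)), fun t c K A G ht hK hG hsupp hA => ?_⟩
  set τ := |t| with hτ
  have hτ0 : 0 < τ := by linarith
  have hK0 : 0 < K := by linarith
  set σ : ℝ := ((SignType.sign t : SignType) : ℝ) with hσ
  have ht0 : t ≠ 0 := by rintro rfl; simp at hτ; linarith
  have hσ1 : |σ| = 1 := by
    rw [hσ]; rcases lt_or_gt_of_ne ht0 with h | h <;> simp [h]
  have hσt : σ * t = τ := sign_mul_self t
  have hc : HasCompactSupport G :=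
    (isCompact_closedBall (0 : R3) (2 * K)).of_isClosed_subset (isClosed_tsupport G) hsupp
  have hzero : ∀ ξ : R3, 2 * K < ‖ξ‖ → ξ ∉ tsupport G := by
    intro ξ hξ h
    have := hsupp h
    simp at this
    linarith
  have hz1 : ∀ ξ : R3, 2 * K < ‖ξ‖ → ‖fderiv ℝ G ξ‖ₑ = 0 := fun ξ hξ => by
    have : fderiv ℝ G ξ = 0 := by
      by_contra h
      exact hzero ξ hξ (support_fderiv_subset ℝ h)
    rw [← ofReal_norm, this, norm_zero, ENNReal.ofReal_zero]
  have hz2 : ∀ ξ : R3, 2 * K < ‖ξ‖ → ‖fderiv ℝ (fderiv ℝ G) ξ‖ₑ = 0 := fun ξ hξ => by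
    have : fderiv ℝ (fderiv ℝ G) ξ = 0 := by
      by_contra h
      exact hzero ξ hξ (tsupport_fderiv_subset ℝ (support_fderiv_subset ℝ h))
    have h0 : ‖fderiv ℝ (fderiv ℝ G) ξ‖ = 0 := by
      rw [this]
      exact ContinuousLinearMap.opNorm_zero
    exact (ofReal_norm (E := R3 →L[ℝ] R3 →L[ℝ] ℂ) _).symm.trans (by rw [h0, ENNReal.ofReal_zero])
  have hcd : Continuous (fderiv ℝ G) := hG.continuous_fderiv two_ne_zero
  have hcdd : Continuous (fderiv ℝ (fderiv ℝ G)) :=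
    (hG.fderiv_right (m := 1) (by norm_num)).continuous_fderiv one_ne_zero
  have hcr : Continuous (damping τ c) := (contDiff_damping c hτ0.le (n := 0)).continuous
  have hcv : Continuous velocity := (contDiff_velocity (n := 0)).continuous
  rw [integral_phaseExp_mul_eq c hτ0.le hσt (hG.of_le (by norm_num)) hc,
    integral_phaseExp_mul_eq c hτ0.le hσt (contDiff_ibpOp c hτ0.le hG) (hasCompactSupport_ibpOp c hc)]
  have b0 := hC₁ τ c A G ht hA
  -- Both choices reach the same rate: `1/2 + (3/2)(5/6) = 7/4` for the pair `(6, 6/5)`, and `1 +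
  -- (3/2)(1/2) = 7/4` for the pair `(2, 2)`.
  have b1 := lintegral_mul_le_of_le_damping c hC₀ hτ0 hK (p := 6) (q := 6 / 5) (α := 1 / 2)
    (β := 3 / 2) (by rw [Real.holderConjugate_iff]; norm_num) (by norm_num)
    (m := fun ξ => ‖velocity ξ + c‖ * damping τ c ξ ^ 2) (by fun_prop) (fun ξ => by positivity)
    (norm_mul_damping_sq_le c hτ0) (h := fun ξ => ‖fderiv ℝ G ξ‖ₑ) (by fun_prop) hz1
  have b2 := lintegral_mul_le_of_le_damping c hC₀ hτ0 hK (p := 2) (q := 2) (α := 1)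
    (β := 1) (by rw [Real.holderConjugate_iff]; norm_num) (by norm_num)
    (m := fun ξ => ‖velocity ξ + c‖ ^ 2 * damping τ c ξ ^ 2) (by fun_prop) (fun ξ => by positivity)
    (norm_sq_mul_damping_sq_le c hτ0) (h := fun ξ => ‖fderiv ℝ (fderiv ℝ G) ξ‖ₑ) (by fun_prop) hz2
  set N := eLpNorm (fderiv ℝ (fderiv ℝ G)) 2 volume with hN
  have e6 : (∫⁻ ξ, ‖fderiv ℝ G ξ‖ₑ ^ (6 : ℝ)) ^ (1 / 6 : ℝ) ≤ C₂ * N := by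
    refine le_trans (le_of_eq ?_) (hC₂ G hG hc)
    rw [eLpNorm_eq_lintegral_rpow_enorm_toReal (by norm_num) (by norm_num)]
    norm_num
  have e2 : (∫⁻ ξ, ‖fderiv ℝ (fderiv ℝ G) ξ‖ₑ ^ (2 : ℝ)) ^ (1 / 2 : ℝ) = N := by
    rw [hN, eLpNorm_eq_lintegral_rpow_enorm_toReal (by norm_num) (by norm_num)]
    norm_num
  rw [e2] at b2
  -- The worst loss in `K` is `K^(5 · 5/6) = K^(25/6)`, from the gradient term; since `K ≥ 1` it
  -- also covers the Hessian term. The factor `243 = 3⁵` in `D` comes from `(3K)⁵`.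
  have hDK : ∀ s : ℝ, 0 ≤ s → s ≤ 5 / 6 → (C₀ * ENNReal.ofReal ((3 * K) ^ 5)) ^ s ≤
      ((D ^ s : ℝ≥0) : ℝ≥0∞) * ENNReal.ofReal (K ^ (25 / 6 : ℝ)) := by
    intro s hs hs'
    have : (C₀ : ℝ≥0∞) * ENNReal.ofReal ((3 * K) ^ 5) = (D : ℝ≥0∞) * ENNReal.ofReal (K ^ 5) := by
      rw [mul_pow, ENNReal.ofReal_mul (by norm_num), ← mul_assoc]
      congr 1
      simp only [D]
      push_cast
      congr 1
      norm_num
    rw [this, ENNReal.mul_rpow_of_nonneg _ _ hs, ENNReal.coe_rpow_of_nonneg _ hs,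
      ENNReal.ofReal_rpow_of_nonneg (by positivity) hs]
    refine mul_le_mul_right (ENNReal.ofReal_le_ofReal ?_) _
    rw [← Real.rpow_natCast, ← Real.rpow_mul hK0.le]
    refine Real.rpow_le_rpow_of_exponent_le hK ?_
    push_cast
    linarith
  set k := ENNReal.ofReal (K ^ (25 / 6 : ℝ)) with hk
  set T := ENNReal.ofReal (τ ^ (-(7 / 4) : ℝ)) with hT
  have b1' : ∫⁻ ξ, ENNReal.ofReal (‖velocity ξ + c‖ * damping τ c ξ ^ 2) * ‖fderiv ℝ G ξ‖ₑ ≤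
      ((D ^ (5 / 6 : ℝ) : ℝ≥0) : ℝ≥0∞) * k * T * (C₂ * N) := by
    refine b1.trans ?_
    have h1 := hDK (5 / 6) (by norm_num) le_rfl
    rw [show (1 / (6 / 5) : ℝ) = 5 / 6 by norm_num,
      show (-(1 / 2 + 3 / (2 * (6 / 5))) : ℝ) = -(7 / 4) by norm_num]
    gcongr
  have b2' : ∫⁻ ξ, ENNReal.ofReal (‖velocity ξ + c‖ ^ 2 * damping τ c ξ ^ 2) *
      ‖fderiv ℝ (fderiv ℝ G) ξ‖ₑ ≤ ((D ^ (1 / 2 : ℝ) : ℝ≥0) : ℝ≥0∞) * k * T * N := by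
    refine b2.trans ?_
    have h1 := hDK (1 / 2) (by norm_num) (by norm_num)
    rw [show (-(1 + 3 / (2 * 2)) : ℝ) = -(7 / 4) by norm_num]
    gcongr
  have hpt : ∀ ξ, ‖phaseExp t c ξ * ibpOp τ σ c (ibpOp τ σ c G) ξ‖ₑ ≤
      84 * (ENNReal.ofReal ((1 + ‖velocity ξ + c‖) * damping τ c ξ ^ 2) * ‖G ξ‖ₑ) +
      (18 * (ENNReal.ofReal (‖velocity ξ + c‖ * damping τ c ξ ^ 2) * ‖fderiv ℝ G ξ‖ₑ) +
      ENNReal.ofReal (‖velocity ξ + c‖ ^ 2 * damping τ c ξ ^ 2) * ‖fderiv ℝ (fderiv ℝ G) ξ‖ₑ) := by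
    intro ξ
    have hr := damping_pos c hτ0.le ξ
    rw [← ofReal_norm, norm_mul, norm_phaseExp, one_mul]
    refine (ENNReal.ofReal_le_ofReal (norm_ibpOp_ibpOp_le c hτ0.le hσ1 hG ξ)).trans ?_
    rw [add_assoc, ENNReal.ofReal_add (by positivity) (by positivity),
      ENNReal.ofReal_add (by positivity) (by positivity), ENNReal.ofReal_mul (by norm_num),
      ENNReal.ofReal_mul (p := (1 + ‖velocity ξ + c‖) * damping τ c ξ ^ 2) (by positivity),
      ENNReal.ofReal_mul (p := 18) (by norm_num),
      ENNReal.ofReal_mul (p := ‖velocity ξ + c‖ * damping τ c ξ ^ 2) (by positivity),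
      ENNReal.ofReal_mul (p := ‖velocity ξ + c‖ ^ 2 * damping τ c ξ ^ 2) (by positivity)]
    have h2 : ENNReal.ofReal ‖fderiv ℝ (fderiv ℝ G) ξ‖ = ‖fderiv ℝ (fderiv ℝ G) ξ‖ₑ :=
      ofReal_norm (E := R3 →L[ℝ] R3 →L[ℝ] ℂ) _
    rw [h2, ofReal_norm, ofReal_norm, ENNReal.ofReal_ofNat, ENNReal.ofReal_ofNat]
  have hGm : Continuous G := hG.continuous
  calc _ ≤ ∫⁻ ξ, ‖phaseExp t c ξ * ibpOp τ σ c (ibpOp τ σ c G) ξ‖ₑ :=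
        enorm_integral_le_lintegral_enorm _
    _ ≤ _ := lintegral_mono hpt
    _ ≤ 84 * (C₁ * (A * ENNReal.ofReal (τ ^ (-(3 / 2) : ℝ)))) +
        (18 * (((D ^ (5 / 6 : ℝ) : ℝ≥0) : ℝ≥0∞) * k * T * (C₂ * N)) +
          ((D ^ (1 / 2 : ℝ) : ℝ≥0) : ℝ≥0∞) * k * T * N) := by
        rw [lintegral_add_left (by fun_prop), lintegral_add_left (by fun_prop),
          lintegral_const_mul _ (by fun_prop), lintegral_const_mul _ (by fun_prop)]
        gcongr
    _ = 84 * C₁ * (A * ENNReal.ofReal (τ ^ (-(3 / 2) : ℝ))) +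
        (18 * ((D ^ (5 / 6 : ℝ) : ℝ≥0) : ℝ≥0∞) * C₂ + ((D ^ (1 / 2 : ℝ) : ℝ≥0) : ℝ≥0∞)) *
          (k * T * N) := by ring
    _ ≤ _ := by
        rw [ENNReal.ofReal_mul (by positivity)]
        push_cast
        rw [mul_add]
        exact add_le_add (mul_le_mul_left le_self_add _) (mul_le_mul_left le_add_self _)

end

/-! ### Plancherel and differentiation of the Fourier transform -/

noncomputable section

open scoped FourierTransform SchwartzMap

/-- The `L²` isometry concerns the abstract extension of the transform, while `𝓕 u` is an integral.
Both pair identically with test functions, by self-adjointness of the transform on each side, so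
they agree almost everywhere. -/
lemma eLpNorm_fourier_two_eq {u : R3 → ℂ} (h1 : Integrable u) (h2 : MemLp u 2) :
    eLpNorm (𝓕 u) 2 volume = eLpNorm u 2 volume := by
  set F : Lp ℂ 2 (volume : Measure R3) := 𝓕 (h2.toLp u) with hF
  have hcont : Continuous (𝓕 u) :=
    VectorFourier.fourierIntegral_continuous Real.continuous_fourierChar
      (by exact continuous_inner) h1
  have hae : ∀ᵐ x, (𝓕 u) x = F x := by
    refine ae_eq_of_integral_contDiff_smul_eq hcont.locallyIntegrable
      ((Lp.memLp F).locallyIntegrable (by norm_num)) fun g hg hgc => ?_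
    have hg' : ContDiff ℝ ((⊤ : ℕ∞) : WithTop ℕ∞) (fun x => (g x : ℂ)) := Complex.ofRealCLM.contDiff.comp hg
    have hgc' : HasCompactSupport (fun x => (g x : ℂ)) := hgc.comp_left Complex.ofReal_zero
    set φ : 𝓢(R3, ℂ) := hgc'.toSchwartzMap hg' with hφ
    have hφx : ∀ x, φ x = (g x : ℂ) := fun x => rfl
    have e1 : ∫ x, g x • F x = ∫ x, (𝓕 φ) x • (h2.toLp u) x := by
      have := congrArg (fun D => D φ) (Lp.fourier_toTemperedDistribution_eq (h2.toLp u))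
      simp only [TemperedDistribution.fourier_apply, Lp.toTemperedDistribution_apply] at this
      rw [this]
      refine integral_congr_ae (Filter.Eventually.of_forall fun x => ?_)
      simp only [hφx, hF, Complex.real_smul, smul_eq_mul]
    have e2 : ∫ x, (𝓕 φ) x • (h2.toLp u) x = ∫ x, (𝓕 φ) x • u x := by
      refine integral_congr_ae ?_
      filter_upwards [h2.coeFn_toLp] with x hx
      rw [hx]
    have e3 := VectorFourier.integral_fourierIntegral_smul_eq_flip (L := innerₗ R3)
      (μ := volume) (ν := volume) Real.continuous_fourierChar (by exact continuous_inner)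
      (φ.integrable (μ := volume)) h1
    rw [e1, e2, SchwartzMap.fourier_coe]
    simp only [flip_innerₗ] at e3
    refine Eq.trans ?_ e3.symm
    refine integral_congr_ae (Filter.Eventually.of_forall fun x => ?_)
    simp only [hφx, smul_eq_mul, Complex.real_smul]
    rfl
  rw [eLpNorm_congr_ae hae]
  have hn : ‖F‖ = ‖h2.toLp u‖ := Lp.norm_fourier_eq _
  rw [Lp.norm_def, Lp.norm_toLp] at hn
  exact (ENNReal.toReal_eq_toReal_iff' (Lp.eLpNorm_ne_top F) h2.eLpNorm_ne_top).1 hn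

lemma fourierHat_eq_fourier (f : R3 → ℂ) (ξ : R3) :
    fourierHat f ξ = 𝓕 f ((2 * Real.pi)⁻¹ • ξ) := by
  rw [fourierHat, Real.fourier_eq']
  refine integral_congr_ae (Filter.Eventually.of_forall fun x => ?_)
  simp only [smul_eq_mul, real_inner_smul_right]
  congr 2
  push_cast
  have : (Real.pi : ℂ) ≠ 0 := by exact_mod_cast Real.pi_ne_zero
  field_simp

lemma eLpNorm_comp_smul_two (h : R3 → ℂ) (hh : Continuous h) {s : ℝ} (hs : 0 < s) :
    eLpNorm (fun ξ => h (s • ξ)) 2 volume =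
      ENNReal.ofReal ((s ^ 3)⁻¹) ^ (1 / 2 : ℝ) * eLpNorm h 2 volume := by
  rw [eLpNorm_eq_lintegral_rpow_enorm_toReal (by norm_num) (by norm_num),
    eLpNorm_eq_lintegral_rpow_enorm_toReal (by norm_num) (by norm_num)]
  rw [lintegral_comp_smul_R3 (g := fun x => ‖h x‖ₑ ^ (2 : ℝ≥0∞).toReal) (by fun_prop) hs,
    ENNReal.mul_rpow_of_nonneg _ _ (by positivity)]
  norm_num

lemma continuous_fourier {f : R3 → ℂ} (h1 : Integrable f) : Continuous (𝓕 f) :=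
  VectorFourier.fourierIntegral_continuous Real.continuous_fourierChar
    (by exact continuous_inner) h1

lemma continuous_fourierHat {f : R3 → ℂ} (h1 : Integrable f) : Continuous (fourierHat f) := by
  rw [funext (fourierHat_eq_fourier f)]
  exact (continuous_fourier h1).comp (continuous_const_smul _)

/-- Plancherel's inequality for `fourierHat`. -/
lemma eLpNorm_fourierHat_two_le : ∃ C : ℝ≥0, ∀ f : R3 → ℂ, Integrable f → MemLp f 2 →
    eLpNorm (fourierHat f) 2 volume ≤ C * eLpNorm f 2 volume := by
  have hs : 0 < (2 * Real.pi)⁻¹ := by positivity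
  have hfin : ENNReal.ofReal (((2 * Real.pi)⁻¹ ^ 3)⁻¹) ^ (1 / 2 : ℝ) ≠ ∞ := by finiteness
  refine ⟨(ENNReal.ofReal (((2 * Real.pi)⁻¹ ^ 3)⁻¹) ^ (1 / 2 : ℝ)).toNNReal, fun f h1 h2 => ?_⟩
  rw [ENNReal.coe_toNNReal hfin, funext (fourierHat_eq_fourier f),
    eLpNorm_comp_smul_two _ (continuous_fourier h1) hs, eLpNorm_fourier_two_eq h1 h2]

/-- Multiplication by `-i x · e`, which corresponds to differentiation of `fourierHat`. -/
def mulCoord (e : R3) (f : R3 → ℂ) (x : R3) : ℂ := -Complex.I * ((inner ℝ x e : ℝ) : ℂ) * f x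

lemma norm_mulCoord_le (e : R3) (f : R3 → ℂ) (x : R3) :
    ‖mulCoord e f x‖ ≤ ‖e‖ * (‖x‖ * ‖f x‖) := by
  rw [mulCoord, norm_mul, norm_mul, norm_neg, Complex.norm_I, one_mul, Complex.norm_real,
    Real.norm_eq_abs, ← mul_assoc, mul_comm ‖e‖]
  exact mul_le_mul_of_nonneg_right (abs_real_inner_le_norm _ _) (norm_nonneg _)

lemma aestronglyMeasurable_mulCoord (e : R3) {f : R3 → ℂ} (hf : AEStronglyMeasurable f) :
    AEStronglyMeasurable (mulCoord e f) := by
  unfold mulCoord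
  exact (Continuous.aestronglyMeasurable (by fun_prop)).mul hf

lemma integrable_mulCoord (e : R3) {f : R3 → ℂ} (hf : AEStronglyMeasurable f)
    (h : Integrable (fun x => ‖x‖ * ‖f x‖)) : Integrable (mulCoord e f) :=
  (h.const_mul ‖e‖).mono' (aestronglyMeasurable_mulCoord e hf)
    (Filter.Eventually.of_forall (norm_mulCoord_le e f))

lemma fderiv_fourierHat_apply {f : R3 → ℂ} (h1 : Integrable f)
    (h2 : Integrable (fun x => ‖x‖ * ‖f x‖)) (ξ e : R3) :
    fderiv ℝ (fourierHat f) ξ e = fourierHat (mulCoord e f) ξ := by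
  have hd := Real.hasFDerivAt_fourier h1 h2 ((2 * Real.pi)⁻¹ • ξ)
  have hs : HasFDerivAt (fun ξ : R3 => (2 * Real.pi)⁻¹ • ξ)
      ((2 * Real.pi)⁻¹ • ContinuousLinearMap.id ℝ R3) ξ :=
    ((2 * Real.pi)⁻¹ • ContinuousLinearMap.id ℝ R3).hasFDerivAt
  have hc := hd.comp ξ hs
  have he : fourierHat f = 𝓕 f ∘ fun ξ => (2 * Real.pi)⁻¹ • ξ :=
    funext (fourierHat_eq_fourier f)
  rw [he, hc.fderiv, fourierHat_eq_fourier]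
  have hint : Integrable (VectorFourier.fourierSMulRight (innerSL ℝ) f) := by
    refine (h2.const_mul (2 * Real.pi * ‖innerSL ℝ (E := R3)‖)).mono'
      h1.aestronglyMeasurable.fourierSMulRight (Filter.Eventually.of_forall fun v => ?_)
    refine (VectorFourier.norm_fourierSMulRight_le _ _ _).trans (le_of_eq (by ring))
  simp only [ContinuousLinearMap.comp_apply, _root_.smul_apply, ContinuousLinearMap.id_apply]
  rw [Real.fourier_eq, ContinuousLinearMap.integral_apply
    ((Real.fourierIntegral_convergent_iff _).2 hint), Real.fourier_eq]
  refine integral_congr_ae (Filter.Eventually.of_forall fun x => ?_)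
  have hi : VectorFourier.fourierSMulRight (innerSL ℝ) f x ((2 * Real.pi)⁻¹ • e) =
      -(2 * Real.pi * Complex.I) • ((2 * Real.pi)⁻¹ * inner ℝ x e) • f x := by
    rw [VectorFourier.fourierSMulRight_apply]
    congr 2
    exact real_inner_smul_right x e _
  simp only [_root_.smul_apply, hi, Circle.smul_def, mulCoord, smul_eq_mul, Complex.real_smul]
  push_cast
  have : (Real.pi : ℂ) ≠ 0 := by exact_mod_cast Real.pi_ne_zero
  field_simp

lemma contDiff_fourierHat {f : R3 → ℂ}
    (hf : ∀ n : ℕ, n ≤ 2 → Integrable (fun x => ‖x‖ ^ n * ‖f x‖)) :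
    ContDiff ℝ 2 (fourierHat f) := by
  rw [funext (fourierHat_eq_fourier f)]
  have := Real.contDiff_fourier (N := 2) (f := f) (fun n hn => hf n (by exact_mod_cast hn))
  exact this.comp (contDiff_const_smul _)

lemma norm_le_sum_norm_basis {F : Type*} [NormedAddCommGroup F] [NormedSpace ℝ F]
    (L : R3 →L[ℝ] F) : ‖L‖ ≤ ∑ i : Fin 3, ‖L (EuclideanSpace.single i 1)‖ := by
  refine L.opNorm_le_bound (Finset.sum_nonneg fun i _ => norm_nonneg _) fun x => ?_
  have hx : x = ∑ i : Fin 3, x i • EuclideanSpace.single i (1 : ℝ) := by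
    ext j
    fin_cases j <;> simp [Fin.sum_univ_three]
  conv_lhs => rw [hx, map_sum]
  refine (norm_sum_le _ _).trans ?_
  rw [Finset.sum_mul]
  refine Finset.sum_le_sum fun i _ => ?_
  rw [map_smul, norm_smul, mul_comm]
  exact mul_le_mul_of_nonneg_left (PiLp.norm_apply_le x i) (norm_nonneg _)

end

/-! ### Bounds on second derivatives of the transform and the frequency cutoff -/

noncomputable section

lemma norm_weightedFun (f : R3 → ℂ) (x : R3) : ‖weightedFun f x‖ = (1 + ‖x‖ ^ 2) * ‖f x‖ := by
  rw [weightedFun, norm_mul, Complex.norm_real, japaneseBracket_sq, Real.norm_of_nonneg (by positivity)]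

lemma eLpNorm_le_three_mul {F : Type*} [NormedAddCommGroup F] [NormedSpace ℝ F]
    {H : R3 → R3 →L[ℝ] F} (hH : Continuous H) {B : ℝ≥0∞}
    (h : ∀ i : Fin 3, eLpNorm (fun ξ => H ξ (EuclideanSpace.single i 1)) 2 volume ≤ B) :
    eLpNorm H 2 volume ≤ 3 * B := by
  calc eLpNorm H 2 volume
      ≤ eLpNorm (∑ i : Fin 3, fun ξ => ‖H ξ (EuclideanSpace.single i 1)‖) 2 volume := by
        refine eLpNorm_mono_real fun ξ => ?_
        rw [Finset.sum_apply]
        exact norm_le_sum_norm_basis (H ξ)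
    _ ≤ ∑ i : Fin 3, eLpNorm (fun ξ => ‖H ξ (EuclideanSpace.single i 1)‖) 2 volume :=
        eLpNorm_sum_le (fun i _ => ((hH.clm_apply continuous_const).norm).aestronglyMeasurable)
          (by norm_num)
    _ ≤ ∑ i : Fin 3, B := Finset.sum_le_sum fun i _ => by rw [eLpNorm_norm]; exact h i
    _ = 3 * B := by simp

/-- `fourierHat f` is bounded in `H²` by the weighted norm of `f`. -/
lemma eLpNorm_fderiv_fourierHat_le : ∃ C : ℝ≥0, ∀ f : R3 → ℂ, AEStronglyMeasurable f →
    (∀ n : ℕ, n ≤ 2 → Integrable (fun x => ‖x‖ ^ n * ‖f x‖)) → MemLp (weightedFun f) 2 →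
    eLpNorm (fourierHat f) 2 volume ≤ C * eLpNorm (weightedFun f) 2 volume ∧
    eLpNorm (fderiv ℝ (fourierHat f)) 2 volume ≤ C * eLpNorm (weightedFun f) 2 volume ∧
    eLpNorm (fderiv ℝ (fderiv ℝ (fourierHat f))) 2 volume ≤
      C * eLpNorm (weightedFun f) 2 volume := by
  obtain ⟨C, hC⟩ := eLpNorm_fourierHat_two_le
  refine ⟨9 * C, fun f hf hmom hw => ?_⟩
  set N := eLpNorm (weightedFun f) 2 volume with hN
  -- Derivatives of the transform up to order two are transforms of `f`, `x_j f` and `x_i x_j f` up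
  -- to unimodular factors, all dominated by `(1 + |x|²) |f|`.
  have key : ∀ h : R3 → ℂ, Integrable h → (∀ x, ‖h x‖ ≤ ‖weightedFun f x‖) →
      eLpNorm (fourierHat h) 2 volume ≤ C * N := by
    intro h hh hle
    refine (hC h hh (hw.mono hh.aestronglyMeasurable (Filter.Eventually.of_forall hle))).trans ?_
    gcongr
    exact eLpNorm_mono hle
  have hm0 : Integrable f := by
    refine (integrable_norm_iff hf).1 ?_
    simpa using hmom 0 (by norm_num)
  have hm1 : Integrable (fun x => ‖x‖ * ‖f x‖) := by simpa using hmom 1 (by norm_num)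
  have hm2 : Integrable (fun x => ‖x‖ ^ 2 * ‖f x‖) := hmom 2 le_rfl
  have hse : ∀ i : Fin 3, ‖EuclideanSpace.single i (1 : ℝ)‖ = 1 := fun i => by simp
  have hi1 : ∀ i : Fin 3, Integrable (mulCoord (EuclideanSpace.single i 1) f) := fun i =>
    integrable_mulCoord _ hf hm1
  have hn1 : ∀ (i : Fin 3) (x : R3), ‖mulCoord (EuclideanSpace.single i 1) f x‖ ≤ ‖x‖ * ‖f x‖ :=
    fun i x => by simpa using norm_mulCoord_le (EuclideanSpace.single i 1) f x
  have hi1' : ∀ i : Fin 3, Integrable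
      (fun x => ‖x‖ * ‖mulCoord (EuclideanSpace.single i 1) f x‖) := fun i => by
    refine hm2.mono' (continuous_norm.aestronglyMeasurable.mul
      (hi1 i).aestronglyMeasurable.norm) (Filter.Eventually.of_forall fun x => ?_)
    rw [norm_mul, norm_norm, norm_norm, pow_two, mul_assoc]
    exact mul_le_mul_of_nonneg_left (hn1 i x) (norm_nonneg _)
  have hn2 : ∀ (i j : Fin 3) (x : R3), ‖mulCoord (EuclideanSpace.single i 1)
      (mulCoord (EuclideanSpace.single j 1) f) x‖ ≤ ‖x‖ ^ 2 * ‖f x‖ := fun i j x => by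
    refine (norm_mulCoord_le _ _ _).trans ?_
    rw [hse, one_mul, pow_two, mul_assoc]
    exact mul_le_mul_of_nonneg_left (hn1 j x) (norm_nonneg _)
  have hg := contDiff_fourierHat hmom
  have c1 : Continuous (fderiv ℝ (fourierHat f)) := hg.continuous_fderiv two_ne_zero
  have d1 : ContDiff ℝ 1 (fderiv ℝ (fourierHat f)) := hg.fderiv_right (by norm_num)
  have c2 : Continuous (fderiv ℝ (fderiv ℝ (fourierHat f))) := d1.continuous_fderiv one_ne_zero
  have k0 : eLpNorm (fourierHat f) 2 volume ≤ C * N := by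
    refine key f hm0 fun x => ?_
    rw [norm_weightedFun]
    nlinarith [norm_nonneg (f x), sq_nonneg ‖x‖, mul_nonneg (sq_nonneg ‖x‖) (norm_nonneg (f x))]
  have k1 : eLpNorm (fderiv ℝ (fourierHat f)) 2 volume ≤ 3 * (C * N) := by
    refine eLpNorm_le_three_mul c1 fun i => ?_
    simp only [fderiv_fourierHat_apply hm0 hm1]
    refine key _ (hi1 i) fun x => (hn1 i x).trans ?_
    rw [norm_weightedFun]
    exact mul_le_mul_of_nonneg_right (by nlinarith [sq_nonneg (‖x‖ - 1)]) (norm_nonneg _)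
  have k2 : eLpNorm (fderiv ℝ (fderiv ℝ (fourierHat f))) 2 volume ≤ 3 * (3 * (C * N)) := by
    refine eLpNorm_le_three_mul c2 fun i => ?_
    refine eLpNorm_le_three_mul (c2.clm_apply continuous_const) fun j => ?_
    have e : (fun ξ => fderiv ℝ (fderiv ℝ (fourierHat f)) ξ (EuclideanSpace.single i 1)
        (EuclideanSpace.single j 1)) = fourierHat (mulCoord (EuclideanSpace.single i 1)
          (mulCoord (EuclideanSpace.single j 1) f)) := by
      ext ξ
      rw [← fderiv_fourierHat_apply (hi1 j) (hi1' j)]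
      have e' : fourierHat (mulCoord (EuclideanSpace.single j 1) f) =
          fun η => fderiv ℝ (fourierHat f) η (EuclideanSpace.single j 1) :=
        funext fun η => (fderiv_fourierHat_apply hm0 hm1 η _).symm
      rw [e', fderiv_clm_apply (d1.differentiable one_ne_zero ξ) (differentiableAt_const _)]
      simp
    rw [e]
    refine key _ (integrable_mulCoord _ (hi1 j).aestronglyMeasurable (hi1' j)) fun x =>
      (hn2 i j x).trans ?_
    rw [norm_weightedFun]
    exact mul_le_mul_of_nonneg_right (by linarith) (norm_nonneg _)
  push_cast
  refine ⟨k0.trans ?_, k1.trans ?_, k2.trans (le_of_eq (by ring))⟩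
  · rw [mul_assoc]
    exact le_mul_of_one_le_left zero_le (by norm_num)
  · rw [mul_assoc]
    gcongr
    norm_num

/-- A smooth bump equal to one on the unit ball and vanishing outside the ball of radius two. -/
def unitBump : ContDiffBump (0 : R3) := ⟨1, 2, one_pos, one_lt_two⟩

/-- A smooth cutoff to frequencies of size at most `2 K`. -/
def cutoff (K : ℝ) (ξ : R3) : ℂ := ((unitBump (K⁻¹ • ξ) : ℝ) : ℂ)

lemma contDiff_cutoff (K : ℝ) {n : ℕ∞} : ContDiff ℝ n (cutoff K) :=
  Complex.ofRealCLM.contDiff.comp (unitBump.contDiff.comp (contDiff_const_smul _))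

lemma norm_cutoff_le_one (K : ℝ) (ξ : R3) : ‖cutoff K ξ‖ ≤ 1 := by
  rw [cutoff, Complex.norm_real, Real.norm_of_nonneg unitBump.nonneg]
  exact unitBump.le_one

lemma norm_one_sub_cutoff_le_one (K : ℝ) (ξ : R3) : ‖1 - cutoff K ξ‖ ≤ 1 := by
  rw [cutoff, ← Complex.ofReal_one, ← Complex.ofReal_sub, Complex.norm_real,
    Real.norm_of_nonneg (sub_nonneg.2 unitBump.le_one)]
  linarith [unitBump.nonneg (x := K⁻¹ • ξ)]

lemma cutoff_eq_one {K : ℝ} (hK : 0 < K) {ξ : R3} (hξ : ‖ξ‖ ≤ K) : cutoff K ξ = 1 := by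
  rw [cutoff, unitBump.one_of_mem_closedBall, Complex.ofReal_one]
  rw [mem_closedBall_zero_iff, norm_smul, Real.norm_of_nonneg (by positivity)]
  show K⁻¹ * ‖ξ‖ ≤ 1
  rw [inv_mul_le_iff₀ hK]
  linarith

lemma cutoff_eq_zero {K : ℝ} (hK : 0 < K) {ξ : R3} (hξ : 2 * K < ‖ξ‖) : cutoff K ξ = 0 := by
  rw [cutoff, unitBump.zero_of_le_dist, Complex.ofReal_zero]
  rw [dist_zero_right, norm_smul, Real.norm_of_nonneg (by positivity)]
  show 2 ≤ K⁻¹ * ‖ξ‖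
  rw [le_inv_mul_iff₀ hK]
  linarith

lemma tsupport_cutoff_subset {K : ℝ} (hK : 0 < K) :
    tsupport (cutoff K) ⊆ Metric.closedBall 0 (2 * K) := by
  refine closure_minimal (fun ξ hξ => ?_) Metric.isClosed_closedBall
  rw [mem_closedBall_zero_iff]
  by_contra h
  exact hξ (cutoff_eq_zero hK (not_le.1 h))

/-- Rescaling a fixed bump multiplies its `i`-th derivative by `K⁻ⁱ ≤ 1`, so the bound is uniform in
`K ≥ 1`. -/
lemma norm_iteratedFDeriv_cutoff_le : ∃ M : ℝ, 0 ≤ M ∧ ∀ K : ℝ, 1 ≤ K → ∀ i : ℕ, i ≤ 2 → ∀ ξ,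
    ‖iteratedFDeriv ℝ i (cutoff K) ξ‖ ≤ M := by
  have hb : ContDiff ℝ ((⊤ : ℕ∞) : WithTop ℕ∞) (fun ξ => ((unitBump ξ : ℝ) : ℂ)) :=
    Complex.ofRealCLM.contDiff.comp unitBump.contDiff
  have hc : HasCompactSupport (fun ξ => ((unitBump ξ : ℝ) : ℂ)) :=
    unitBump.hasCompactSupport.comp_left Complex.ofReal_zero
  have h : ∀ i : ℕ, ∃ M, ∀ ξ, ‖iteratedFDeriv ℝ i (fun ξ => ((unitBump ξ : ℝ) : ℂ)) ξ‖ ≤ M :=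
    fun i => (hc.iteratedFDeriv i).exists_bound_of_continuous
      (hb.continuous_iteratedFDeriv (by exact_mod_cast le_top))
  choose M hM using h
  have hM0 : ∀ i, 0 ≤ M i := fun i => (norm_nonneg _).trans (hM i 0)
  refine ⟨M 0 + M 1 + M 2, by linarith [hM0 0, hM0 1, hM0 2], fun K hK i hi ξ => ?_⟩
  have hK0 : 0 < K := by linarith
  have e := iteratedFDeriv_comp_const_smul (𝕜 := ℝ) (i := i) K⁻¹
    (hb.of_le (by exact_mod_cast le_top))
  have e' : iteratedFDeriv ℝ i (cutoff K) ξ =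
      K⁻¹ ^ i • iteratedFDeriv ℝ i (fun ξ => ((unitBump ξ : ℝ) : ℂ)) (K⁻¹ • ξ) := congrFun e ξ
  rw [e', norm_smul, Real.norm_of_nonneg (by positivity)]
  refine (mul_le_of_le_one_left (norm_nonneg _)
    (pow_le_one₀ (by positivity) (inv_le_one_of_one_le₀ hK))).trans ?_
  refine (hM i _).trans ?_
  interval_cases i <;> linarith [hM0 0, hM0 1, hM0 2]

lemma norm_iteratedFDeriv_two {F : Type*} [NormedAddCommGroup F] [NormedSpace ℝ F]
    (h : R3 → F) (ξ : R3) :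
    ‖iteratedFDeriv ℝ 2 h ξ‖ = ‖fderiv ℝ (fderiv ℝ h) ξ‖ := by
  rw [← norm_iteratedFDeriv_fderiv, ← norm_iteratedFDeriv_fderiv, norm_iteratedFDeriv_zero]

lemma norm_iteratedFDeriv_one' {F : Type*} [NormedAddCommGroup F] [NormedSpace ℝ F]
    (h : R3 → F) (ξ : R3) : ‖iteratedFDeriv ℝ 1 h ξ‖ = ‖fderiv ℝ h ξ‖ := by
  rw [← norm_iteratedFDeriv_fderiv, norm_iteratedFDeriv_zero]

lemma eLpNorm_fderiv_fderiv_cutoff_mul_le : ∃ C : ℝ≥0, ∀ (K : ℝ) (g : R3 → ℂ), 1 ≤ K →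
    ContDiff ℝ 2 g → eLpNorm (fderiv ℝ (fderiv ℝ (fun ξ => cutoff K ξ * g ξ))) 2 volume ≤
      C * (eLpNorm g 2 volume + eLpNorm (fderiv ℝ g) 2 volume +
        eLpNorm (fderiv ℝ (fderiv ℝ g)) 2 volume) := by
  obtain ⟨M, hM0, hM⟩ := norm_iteratedFDeriv_cutoff_le
  refine ⟨(2 * M).toNNReal, fun K g hK hg => ?_⟩
  have c0 : Continuous g := hg.continuous
  have c1 : Continuous (fderiv ℝ g) := hg.continuous_fderiv two_ne_zero
  have c2 : Continuous (fderiv ℝ (fderiv ℝ g)) :=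
    (hg.fderiv_right (m := 1) (by norm_num)).continuous_fderiv one_ne_zero
  have hpt : ∀ ξ, ‖fderiv ℝ (fderiv ℝ (fun ξ => cutoff K ξ * g ξ)) ξ‖ ≤
      2 * M * ‖‖g ξ‖ + ‖fderiv ℝ g ξ‖ + ‖fderiv ℝ (fderiv ℝ g) ξ‖‖ := by
    intro ξ
    have h := norm_iteratedFDeriv_mul_le (contDiff_cutoff K (n := 2)) hg ξ (n := 2) le_rfl
    rw [norm_iteratedFDeriv_two] at h
    refine h.trans ?_
    have e1 : ‖iteratedFDeriv ℝ (2 - 1) g ξ‖ = ‖fderiv ℝ g ξ‖ := norm_iteratedFDeriv_one' g ξ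
    have e2 : ‖iteratedFDeriv ℝ (2 - 2) g ξ‖ = ‖g ξ‖ := norm_iteratedFDeriv_zero
    rw [Finset.sum_range_succ, Finset.sum_range_succ, Finset.sum_range_one, e1, e2, Nat.sub_zero]
    simp only [Nat.choose_zero_right, Nat.choose_self, Nat.choose_one_right,
      norm_iteratedFDeriv_zero, norm_iteratedFDeriv_two, norm_iteratedFDeriv_one']
    have h0 := hM K hK 0 (by norm_num) ξ
    have h1 := hM K hK 1 (by norm_num) ξ
    have h2 := hM K hK 2 (by norm_num) ξ
    simp only [norm_iteratedFDeriv_zero, norm_iteratedFDeriv_two, norm_iteratedFDeriv_one'] at h0 h1 h2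
    have n0 := norm_nonneg (g ξ)
    have n1 := norm_nonneg (fderiv ℝ g ξ)
    have n2 := norm_nonneg (fderiv ℝ (fderiv ℝ g) ξ)
    rw [Real.norm_of_nonneg (by positivity)]
    push_cast
    nlinarith [mul_le_mul_of_nonneg_right h0 n2, mul_le_mul_of_nonneg_right h1 n1,
      mul_le_mul_of_nonneg_right h2 n0, mul_nonneg hM0 n0, mul_nonneg hM0 n1, mul_nonneg hM0 n2]
  have h1 := eLpNorm_le_mul_eLpNorm_of_ae_le_mul (μ := volume)
    (f := fderiv ℝ (fderiv ℝ (fun ξ => cutoff K ξ * g ξ)))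
    (Filter.Eventually.of_forall fun ξ => hpt ξ) 2
  refine h1.trans ?_
  rw [ENNReal.ofReal]
  refine mul_le_mul_right ?_ _
  have m2 : AEStronglyMeasurable (fun ξ => ‖fderiv ℝ (fderiv ℝ g) ξ‖) :=
    ((continuous_norm (E := R3 →L[ℝ] R3 →L[ℝ] ℂ)).comp c2).aestronglyMeasurable
  have n2 : eLpNorm (fun ξ => ‖fderiv ℝ (fderiv ℝ g) ξ‖) 2 volume =
      eLpNorm (fderiv ℝ (fderiv ℝ g)) 2 volume := eLpNorm_norm (fderiv ℝ (fderiv ℝ g))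
  refine (eLpNorm_add_le (by fun_prop) m2 (by norm_num)).trans ?_
  refine (add_le_add_left (eLpNorm_add_le (by fun_prop) (by fun_prop) (by norm_num)) _).trans ?_
  rw [eLpNorm_norm, eLpNorm_norm, n2]

end

/-! ### Truncation in space, and the low and high frequencies -/

noncomputable section

lemma memLp_inv_japaneseBracket_sq :
    MemLp (fun x => ((japaneseBracket x ^ 2)⁻¹ : ℝ)) 2 (volume : Measure R3) := by
  have hc : Continuous (fun x => ((japaneseBracket x ^ 2)⁻¹ : ℝ)) :=
    ((contDiff_japaneseBracket (n := 0)).continuous.pow 2).inv₀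
      fun x => (pow_pos (japaneseBracket_pos x) 2).ne'
  rw [memLp_two_iff_integrable_sq hc.aestronglyMeasurable]
  have := integrable_rpow_neg_one_add_norm_sq (E := R3) (μ := volume) (r := 4)
    (by rw [finrank_euclideanSpace_fin]; norm_num)
  refine this.congr (Filter.Eventually.of_forall fun x => ?_)
  simp only [japaneseBracket_sq]
  rw [show (-4 / 2 : ℝ) = -(2 : ℕ) by norm_num, Real.rpow_neg (by positivity), Real.rpow_natCast,
    inv_pow]

/-- Cauchy-Schwarz, as `⟨x⟩⁻²` is square integrable in dimension three. -/
lemma integrable_of_memLp_weightedFun {f : R3 → ℂ} (hf : MemLp (weightedFun f) 2) :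
    Integrable f := by
  have h1 : MemLp (fun x => (((japaneseBracket x ^ 2)⁻¹ : ℝ) : ℂ)) 2 (volume : Measure R3) :=
    memLp_inv_japaneseBracket_sq.ofReal
  refine (MemLp.integrable_mul h1 hf).congr (Filter.Eventually.of_forall fun x => ?_)
  have h2 : (japaneseBracket x : ℂ) ≠ 0 := by exact_mod_cast (japaneseBracket_pos x).ne'
  simp only [Pi.mul_apply, weightedFun]
  push_cast
  field_simp

lemma norm_fourierHat_sub_le {f h : R3 → ℂ} (hf : Integrable f) (hh : Integrable h) (ξ : R3) :
    ‖fourierHat f ξ - fourierHat h ξ‖ ≤ ∫ x, ‖f x - h x‖ := by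
  have hm : ∀ u : R3 → ℂ, Integrable u →
      Integrable (fun x => Complex.exp (-Complex.I * ((inner ℝ x ξ : ℝ) : ℂ)) * u x) := by
    intro u hu
    refine hu.mono ((Continuous.aestronglyMeasurable (by fun_prop)).mul hu.aestronglyMeasurable)
      (Filter.Eventually.of_forall fun x => ?_)
    rw [norm_mul, neg_mul, mul_comm Complex.I, ← neg_mul, ← Complex.ofReal_neg,
      Complex.norm_exp_ofReal_mul_I, one_mul]
  rw [fourierHat, fourierHat, ← integral_sub (hm f hf) (hm h hh)]
  refine (norm_integral_le_integral_norm _).trans (le_of_eq ?_)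
  refine integral_congr_ae (Filter.Eventually.of_forall fun x => ?_)
  simp only
  rw [← mul_sub, norm_mul, neg_mul, mul_comm Complex.I, ← neg_mul, ← Complex.ofReal_neg,
      Complex.norm_exp_ofReal_mul_I, one_mul]

/-- The truncation of `f` to the ball of radius `n`. -/
def truncate (n : ℕ) (f : R3 → ℂ) : R3 → ℂ := (Metric.closedBall 0 (n : ℝ)).indicator f

lemma norm_truncate_le (n : ℕ) (f : R3 → ℂ) (x : R3) : ‖truncate n f x‖ ≤ ‖f x‖ :=
  norm_indicator_le_norm_self _ _

lemma integrable_truncate (n : ℕ) {f : R3 → ℂ} (hf : Integrable f) : Integrable (truncate n f) :=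
  hf.indicator Metric.isClosed_closedBall.measurableSet

/-- The hypothesis on `f` does not make `|x|² |f|` integrable, so the transform of `f` need not be
`C²` in the classical sense. Truncated functions have all moments, and the estimate passes to the
limit. -/
lemma integrable_pow_mul_truncate (n k : ℕ) {f : R3 → ℂ} (hf : Integrable f) :
    Integrable (fun x => ‖x‖ ^ k * ‖truncate n f x‖) := by
  refine (hf.norm.const_mul ((n : ℝ) ^ k)).mono'
    ((continuous_norm.pow k).aestronglyMeasurable.mul
      (integrable_truncate n hf).aestronglyMeasurable.norm) (Filter.Eventually.of_forall fun x => ?_)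
  rw [Real.norm_of_nonneg (by positivity)]
  by_cases hx : x ∈ Metric.closedBall (0 : R3) (n : ℝ)
  · rw [mem_closedBall_zero_iff] at hx
    exact mul_le_mul (pow_le_pow_left₀ (norm_nonneg _) hx k) (norm_truncate_le n f x)
      (norm_nonneg _) (by positivity)
  · rw [truncate, Set.indicator_of_notMem hx, norm_zero, mul_zero]
    positivity

lemma norm_weightedFun_truncate_le (n : ℕ) (f : R3 → ℂ) (x : R3) :
    ‖weightedFun (truncate n f) x‖ ≤ ‖weightedFun f x‖ := by
  rw [norm_weightedFun, norm_weightedFun]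
  exact mul_le_mul_of_nonneg_left (norm_truncate_le n f x) (by positivity)

lemma memLp_weightedFun_truncate (n : ℕ) {f : R3 → ℂ} (hf : MemLp (weightedFun f) 2) :
    MemLp (weightedFun (truncate n f)) 2 := by
  have hi := integrable_of_memLp_weightedFun hf
  refine hf.mono ?_ (Filter.Eventually.of_forall (norm_weightedFun_truncate_le n f))
  exact (Complex.continuous_ofReal.comp
    ((contDiff_japaneseBracket (n := 0)).continuous.pow 2)).aestronglyMeasurable.mul
    (integrable_truncate n hi).aestronglyMeasurable

lemma tendsto_integral_sub_truncate {f : R3 → ℂ} (hf : Integrable f) :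
    Filter.Tendsto (fun n => ∫ x, ‖f x - truncate n f x‖) Filter.atTop (nhds 0) := by
  have := tendsto_integral_of_dominated_convergence (μ := volume)
    (F := fun n x => ‖f x - truncate n f x‖) (f := fun _ => (0 : ℝ)) (fun x => ‖f x‖ + ‖f x‖)
    (fun n => (hf.sub (integrable_truncate n hf)).aestronglyMeasurable.norm)
    (hf.norm.add hf.norm)
    (fun n => Filter.Eventually.of_forall fun x => by
      rw [norm_norm]
      exact (norm_sub_le _ _).trans (add_le_add le_rfl (norm_truncate_le n f x)))
    (Filter.Eventually.of_forall fun x => by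
      refine tendsto_const_nhds.congr' ?_
      filter_upwards [Filter.eventually_ge_atTop ⌈‖x‖⌉₊] with n hn
      have hx : x ∈ Metric.closedBall (0 : R3) (n : ℝ) := by
        rw [mem_closedBall_zero_iff]
        exact (Nat.le_ceil _).trans (by exact_mod_cast hn)
      rw [truncate, Set.indicator_of_mem hx, sub_self, norm_zero])
  simpa using this

lemma ae_enorm_fourierHat_le (f : R3 → ℂ) : ∀ᵐ ξ, ‖fourierHat f ξ‖ₑ ≤
    eLpNorm (weightedHat f) ∞ volume * ENNReal.ofReal (((1 + ‖ξ‖) ^ 6)⁻¹) := by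
  rw [eLpNorm_exponent_top]
  filter_upwards [enorm_ae_le_eLpNormEssSup (weightedHat f) volume] with ξ hξ
  have h0 : (0 : ℝ) < (1 + ‖ξ‖) ^ 6 := by positivity
  have e : ‖fourierHat f ξ‖ₑ = ‖weightedHat f ξ‖ₑ * ENNReal.ofReal (((1 + ‖ξ‖) ^ 6)⁻¹) := by
    rw [← ofReal_norm, ← ofReal_norm, ← ENNReal.ofReal_mul (norm_nonneg _), weightedHat, norm_mul,
      Complex.norm_real, Real.norm_of_nonneg h0.le]
    congr 1
    field_simp
  rw [e]
  gcongr

/-- The low-frequency part of the dispersive estimate. -/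
lemma enorm_integral_cutoff_le : ∃ C : ℝ≥0, ∀ (f : R3 → ℂ) (t : ℝ) (c : R3) (K : ℝ),
    MemLp (weightedFun f) 2 → 1 ≤ |t| → 1 ≤ K →
    ‖∫ ξ, phaseExp t c ξ * (cutoff K ξ * fourierHat f ξ)‖ₑ ≤
      C * (eLpNorm (weightedHat f) ∞ volume * ENNReal.ofReal (|t| ^ (-(3 / 2) : ℝ)) +
        ENNReal.ofReal (K ^ (25 / 6 : ℝ) * |t| ^ (-(7 / 4) : ℝ)) *
          eLpNorm (weightedFun f) 2 volume) := by
  obtain ⟨C₁, hC₁⟩ := enorm_integral_phaseExp_mul_le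
  obtain ⟨C₂, hC₂⟩ := eLpNorm_fderiv_fderiv_cutoff_mul_le
  obtain ⟨C₃, hC₃⟩ := eLpNorm_fderiv_fourierHat_le
  refine ⟨C₁ * (1 + C₂ * (3 * C₃)), fun f t c K hf ht hK => ?_⟩
  have hK0 : 0 < K := by linarith
  set A := eLpNorm (weightedHat f) ∞ volume with hAdef
  set N := eLpNorm (weightedFun f) 2 volume with hN
  set T := ENNReal.ofReal (|t| ^ (-(3 / 2) : ℝ)) with hT
  set X := ENNReal.ofReal (K ^ (25 / 6 : ℝ) * |t| ^ (-(7 / 4) : ℝ)) with hX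
  have hi := integrable_of_memLp_weightedFun hf
  set δ : ℕ → ℝ := fun n => ∫ x, ‖f x - truncate n f x‖ with hδ
  have hδ0 : ∀ n, 0 ≤ δ n := fun n => integral_nonneg fun x => norm_nonneg _
  have hdist : ∀ n ξ, ‖fourierHat f ξ - fourierHat (truncate n f) ξ‖ ≤ δ n := fun n ξ =>
    norm_fourierHat_sub_le hi (integrable_truncate n hi) ξ
  set k := ENNReal.ofReal ((1 + 2 * K) ^ 6) with hk
  set v := volume (Metric.closedBall (0 : R3) (2 * K)) with hv
  have hvtop : v ≠ ∞ := measure_closedBall_lt_top.ne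
  have hχc : Continuous (cutoff K) := (contDiff_cutoff K (n := 0)).continuous
  have hχs : HasCompactSupport (cutoff K) :=
    (isCompact_closedBall (0 : R3) (2 * K)).of_isClosed_subset (isClosed_tsupport _)
      (tsupport_cutoff_subset hK0)
  have hE : Continuous (phaseExp t c) := (contDiff_phaseExp t c (n := 0)).continuous
  have hint : ∀ g : R3 → ℂ, Continuous g →
      Integrable (fun ξ => phaseExp t c ξ * (cutoff K ξ * g ξ)) := fun g hg =>
    (hE.mul (hχc.mul hg)).integrable_of_hasCompactSupport hχs.mul_right.mul_left
  -- The transform of the truncation is within `δ n` of that of `f`, uniformly in frequency. This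
  -- error enters twice: in the sup-norm bound of the amplitude, and in the difference of the two
  -- integrals over the support of the cutoff.
  have bound : ∀ n, ‖∫ ξ, phaseExp t c ξ * (cutoff K ξ * fourierHat f ξ)‖ₑ ≤
      C₁ * ((A + ENNReal.ofReal (δ n) * k) * T + X * (C₂ * (3 * (C₃ * N)))) +
        ENNReal.ofReal (δ n) * v := by
    intro n
    set g := fourierHat f with hg
    set h := fourierHat (truncate n f) with hh
    have hgc : Continuous g := continuous_fourierHat hi
    have hhc : Continuous h := continuous_fourierHat (integrable_truncate n hi)
    have hmom : ∀ m : ℕ, m ≤ 2 → Integrable (fun x => ‖x‖ ^ m * ‖truncate n f x‖) := fun m _ =>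
      integrable_pow_mul_truncate n m hi
    have hh2 : ContDiff ℝ 2 h := contDiff_fourierHat hmom
    have split : ∫ ξ, phaseExp t c ξ * (cutoff K ξ * g ξ) =
        (∫ ξ, phaseExp t c ξ * (cutoff K ξ * h ξ)) +
          ∫ ξ, phaseExp t c ξ * (cutoff K ξ * (g ξ - h ξ)) := by
      rw [← integral_add (hint h hhc) (hint (fun ξ => g ξ - h ξ) (hgc.sub hhc))]
      refine integral_congr_ae (Filter.Eventually.of_forall fun ξ => ?_)
      simp only
      ring
    rw [split]
    refine (enorm_add_le _ _).trans (add_le_add ?_ ?_)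
    · refine (hC₁ t c K (A + ENNReal.ofReal (δ n) * k) (fun ξ => cutoff K ξ * h ξ) ht hK
        ((contDiff_cutoff K (n := 2)).mul hh2)
        ((tsupport_mul_subset_left).trans (tsupport_cutoff_subset hK0)) ?_).trans ?_
      · filter_upwards [ae_enorm_fourierHat_le f] with ξ hξ
        rcases lt_or_ge (2 * K) ‖ξ‖ with hbig | hsmall
        · rw [cutoff_eq_zero hK0 hbig, zero_mul, enorm_zero]
          exact zero_le
        · have h1 : ‖cutoff K ξ * h ξ‖ₑ ≤ ‖h ξ‖ₑ := by
            rw [← ofReal_norm, ← ofReal_norm, norm_mul]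
            exact ENNReal.ofReal_le_ofReal
              (mul_le_of_le_one_left (norm_nonneg _) (norm_cutoff_le_one K ξ))
          have h2 : ‖h ξ‖ₑ ≤ ‖g ξ‖ₑ + ENNReal.ofReal (δ n) := by
            rw [← ofReal_norm, ← ofReal_norm, ← ENNReal.ofReal_add (norm_nonneg _) (hδ0 n)]
            refine ENNReal.ofReal_le_ofReal ?_
            have := norm_sub_norm_le (h ξ) (g ξ)
            rw [norm_sub_rev] at this
            linarith [hdist n ξ]
          -- On the support of the cutoff a constant is at most `k` times the weight `(1 + |ξ|)⁻⁶`.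
          -- The size of `k` is irrelevant, since `n` tends to infinity with `K` fixed.
          have h3 : ENNReal.ofReal (δ n) ≤
              ENNReal.ofReal (δ n) * k * ENNReal.ofReal (((1 + ‖ξ‖) ^ 6)⁻¹) := by
            rw [mul_assoc, hk, ← ENNReal.ofReal_mul (by positivity)]
            refine le_mul_of_one_le_right zero_le (ENNReal.one_le_ofReal.2 ?_)
            rw [← div_eq_mul_inv, one_le_div (by positivity)]
            gcongr
          rw [add_mul]
          exact h1.trans (h2.trans (add_le_add hξ h3))
      · have hd := hC₃ (truncate n f) (integrable_truncate n hi).aestronglyMeasurable hmom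
          (memLp_weightedFun_truncate n hf)
        have hNn : eLpNorm (weightedFun (truncate n f)) 2 volume ≤ N :=
          eLpNorm_mono (norm_weightedFun_truncate_le n f)
        have hd0 := hd.1.trans (mul_le_mul_right hNn _)
        have hd1 := hd.2.1.trans (mul_le_mul_right hNn _)
        have hd2 := hd.2.2.trans (mul_le_mul_right hNn _)
        have hb := (hC₂ K h hK hh2).trans
          (mul_le_mul_right (add_le_add (add_le_add hd0 hd1) hd2) _)
        rw [show (C₃ : ℝ≥0∞) * N + C₃ * N + C₃ * N = 3 * (C₃ * N) by ring] at hb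
        gcongr
    · refine (enorm_integral_le_lintegral_enorm _).trans ?_
      calc _ ≤ ∫⁻ ξ, (Metric.closedBall (0 : R3) (2 * K)).indicator
            (fun _ => ENNReal.ofReal (δ n)) ξ := by
            refine lintegral_mono fun ξ => ?_
            by_cases hξ : ξ ∈ Metric.closedBall (0 : R3) (2 * K)
            · rw [Set.indicator_of_mem hξ, ← ofReal_norm, norm_mul, norm_mul, norm_phaseExp, one_mul]
              refine ENNReal.ofReal_le_ofReal ?_
              exact (mul_le_of_le_one_left (norm_nonneg _) (norm_cutoff_le_one K ξ)).trans
                (hdist n ξ)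
            · rw [Set.indicator_of_notMem hξ]
              rw [mem_closedBall_zero_iff, not_le] at hξ
              rw [cutoff_eq_zero hK0 hξ, zero_mul, mul_zero, enorm_zero]
        _ = _ := by
            rw [lintegral_indicator_const Metric.isClosed_closedBall.measurableSet]
  have hlim : Filter.Tendsto (fun n => ENNReal.ofReal (δ n)) Filter.atTop (nhds 0) := by
    have := ENNReal.tendsto_ofReal (tendsto_integral_sub_truncate hi)
    rwa [ENNReal.ofReal_zero] at this
  have hktop : k ≠ ∞ := ENNReal.ofReal_ne_top
  have hTtop : T ≠ ∞ := ENNReal.ofReal_ne_top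
  have l1 : Filter.Tendsto (fun n => ENNReal.ofReal (δ n) * k) Filter.atTop (nhds (0 * k)) :=
    ENNReal.Tendsto.mul_const hlim (Or.inr hktop)
  have l2 : Filter.Tendsto (fun n => (A + ENNReal.ofReal (δ n) * k) * T) Filter.atTop
      (nhds ((A + 0 * k) * T)) :=
    ENNReal.Tendsto.mul_const (tendsto_const_nhds.add l1) (Or.inr hTtop)
  have l3 := ENNReal.Tendsto.const_mul (a := (C₁ : ℝ≥0∞))
    (l2.add (tendsto_const_nhds (x := X * (C₂ * (3 * (C₃ * N)))))) (Or.inr ENNReal.coe_ne_top)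
  have l4 := l3.add (ENNReal.Tendsto.mul_const (b := v) hlim (Or.inr hvtop))
  refine (ge_of_tendsto' l4 bound).trans ?_
  rw [zero_mul, zero_mul, add_zero, add_zero]
  push_cast
  rw [mul_assoc (C₁ : ℝ≥0∞)]
  refine mul_le_mul_right ?_ _
  rw [mul_add]
  refine add_le_add (le_mul_of_one_le_left zero_le le_self_add) ?_
  rw [show X * (C₂ * (3 * (C₃ * N))) = (C₂ * (3 * C₃) : ℝ≥0∞) * (X * N) by ring]
  exact mul_le_mul_left le_add_self _

/-- The high-frequency part of the dispersive estimate. -/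
lemma lintegral_one_sub_cutoff_le : ∃ C : ℝ≥0, ∀ (f : R3 → ℂ) (K : ℝ), Integrable f → 1 ≤ K →
    ∫⁻ ξ, ‖(1 - cutoff K ξ) * fourierHat f ξ‖ₑ ≤
      C * (ENNReal.ofReal ((K ^ 48)⁻¹) * sobolevENorm 50 f) := by
  set I := eLpNorm (fun x => ((japaneseBracket x ^ 2)⁻¹ : ℝ)) 2 (volume : Measure R3) with hI
  have hItop : I ≠ ∞ := memLp_inv_japaneseBracket_sq.eLpNorm_ne_top
  set P := ENNReal.ofReal ((2 * Real.pi) ^ ((3 / 2) : ℝ)) with hP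
  refine ⟨(I * P).toNNReal, fun f K hf hK => ?_⟩
  rw [ENNReal.coe_toNNReal (ENNReal.mul_ne_top hItop ENNReal.ofReal_ne_top)]
  have hK0 : 0 < K := by linarith
  have hJc : Continuous japaneseBracket := (contDiff_japaneseBracket (n := 0)).continuous
  have hgc := continuous_fourierHat hf
  set h : R3 → ℂ := fun ξ => ((japaneseBracket ξ ^ 50 : ℝ) : ℂ) * fourierHat f ξ with hh
  have hhc : Continuous h := (Complex.continuous_ofReal.comp (hJc.pow 50)).mul hgc
  have hwc : Continuous (fun x => ((japaneseBracket x ^ 2)⁻¹ : ℝ)) :=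
    (hJc.pow 2).inv₀ fun x => (pow_pos (japaneseBracket_pos x) 2).ne'
  have hS : eLpNorm h 2 volume = P * sobolevENorm 50 f := by
    rw [sobolevENorm, ← mul_assoc, hP, ← ENNReal.ofReal_mul (by positivity),
      ← Real.rpow_add (by positivity), add_neg_cancel, Real.rpow_zero, ENNReal.ofReal_one, one_mul]
  have hpt : ∀ ξ, ‖(1 - cutoff K ξ) * fourierHat f ξ‖ₑ ≤
      ENNReal.ofReal ((K ^ 48)⁻¹) * (‖((japaneseBracket ξ ^ 2)⁻¹ : ℝ)‖ₑ * ‖h ξ‖ₑ) := by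
    intro ξ
    rcases le_or_gt ‖ξ‖ K with hs | hb
    · rw [cutoff_eq_one hK0 hs, sub_self, zero_mul, enorm_zero]
      exact zero_le
    · have hJ0 := japaneseBracket_pos ξ
      have hJ : K ≤ japaneseBracket ξ := hb.le.trans (norm_le_japaneseBracket ξ)
      rw [← ofReal_norm, ← ofReal_norm, ← ofReal_norm, ← ENNReal.ofReal_mul (norm_nonneg _),
        ← ENNReal.ofReal_mul (by positivity)]
      refine ENNReal.ofReal_le_ofReal ?_
      rw [norm_mul, hh, norm_mul, Complex.norm_real, Real.norm_of_nonneg (by positivity),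
        Real.norm_of_nonneg (by positivity)]
      refine (mul_le_of_le_one_left (norm_nonneg _) (norm_one_sub_cutoff_le_one K ξ)).trans ?_
      -- Of the fifty powers of `⟨ξ⟩`, two are kept to make `⟨ξ⟩⁻²` square integrable; the other
      -- forty-eight are at least `K^48` where the integrand does not vanish.
      have h1 : 1 ≤ (K ^ 48)⁻¹ * japaneseBracket ξ ^ 48 := by
        rw [← div_eq_inv_mul, one_le_div (by positivity)]
        gcongr
      have h2 : (K ^ 48)⁻¹ * ((japaneseBracket ξ ^ 2)⁻¹ * (japaneseBracket ξ ^ 50 *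
          ‖fourierHat f ξ‖)) = (K ^ 48)⁻¹ * japaneseBracket ξ ^ 48 * ‖fourierHat f ξ‖ := by
        field_simp
      rw [h2]
      exact le_mul_of_one_le_left (norm_nonneg _) h1
  calc _ ≤ ∫⁻ ξ, ENNReal.ofReal ((K ^ 48)⁻¹) *
        (‖((japaneseBracket ξ ^ 2)⁻¹ : ℝ)‖ₑ * ‖h ξ‖ₑ) := lintegral_mono hpt
    _ = ENNReal.ofReal ((K ^ 48)⁻¹) * ∫⁻ ξ, ‖((japaneseBracket ξ ^ 2)⁻¹ : ℝ)‖ₑ * ‖h ξ‖ₑ :=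
        lintegral_const_mul' _ _ ENNReal.ofReal_ne_top
    _ ≤ ENNReal.ofReal ((K ^ 48)⁻¹) * (I * eLpNorm h 2 volume) := by
        refine mul_le_mul_right ?_ _
        have := ENNReal.lintegral_mul_le_Lp_mul_Lq (volume : Measure R3)
          (p := 2) (q := 2) (by rw [Real.holderConjugate_iff]; norm_num)
          (f := fun ξ => ‖((japaneseBracket ξ ^ 2)⁻¹ : ℝ)‖ₑ) (g := fun ξ => ‖h ξ‖ₑ)
          (by fun_prop) (by fun_prop)
        rw [hI, eLpNorm_eq_lintegral_rpow_enorm_toReal (by norm_num) (by norm_num),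
          eLpNorm_eq_lintegral_rpow_enorm_toReal (by norm_num) (by norm_num)]
        simpa using this
    _ = _ := by rw [hS]; ring

end

/-! ### Choice of the cutoff and conclusion -/

noncomputable section

lemma enorm_propagator_le (t : ℝ) (f : R3 → ℂ) (x : R3) :
    ‖propagator t f x‖ₑ ≤ ‖∫ ξ, Complex.exp (Complex.I * ((inner ℝ x ξ : ℝ) : ℂ)) *
      (Complex.exp (Complex.I * (t : ℂ) * (japaneseBracket ξ : ℂ)) * fourierHat f ξ)‖ₑ := by
  rw [propagator, fourierMultiplierOp, enorm_mul]
  refine mul_le_of_le_one_left zero_le ?_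
  rw [← ofReal_norm, Complex.norm_real, Real.norm_of_nonneg (by positivity)]
  refine ENNReal.ofReal_le_one.2 (inv_le_one_of_one_le₀ (one_le_pow₀ ?_))
  linarith [Real.pi_gt_three]

lemma rpow_neg_le_four_mul {T s : ℝ} (hT : 1 ≤ T) (hs0 : 0 ≤ s) (hs : s ≤ 2) :
    T ^ (-s) ≤ 4 * (1 + T) ^ (-s) := by
  have hT0 : 0 < T := by linarith
  have h1 : (1 + T) ^ s ≤ 4 * T ^ s := by
    calc (1 + T) ^ s ≤ (2 * T) ^ s := Real.rpow_le_rpow (by linarith) (by linarith) hs0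
      _ = 2 ^ s * T ^ s := Real.mul_rpow (by norm_num) hT0.le
      _ ≤ 2 ^ (2 : ℝ) * T ^ s := by
          gcongr
          norm_num
      _ = 4 * T ^ s := by norm_num
  rw [Real.rpow_neg hT0.le, Real.rpow_neg (by linarith), ← div_eq_mul_inv,
    le_div_iff₀ (by positivity), inv_mul_le_iff₀ (by positivity)]
  linarith

lemma lintegral_enorm_fourierHat_le : ∃ C : ℝ≥0, ∀ f : R3 → ℂ,
    ∫⁻ ξ, ‖fourierHat f ξ‖ₑ ≤ C * eLpNorm (weightedHat f) ∞ volume := by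
  have hfin := integrable_one_add_norm_pow_six.lintegral_lt_top.ne
  refine ⟨(∫⁻ ξ : R3, ENNReal.ofReal (((1 + ‖ξ‖) ^ 6)⁻¹)).toNNReal, fun f => ?_⟩
  rw [ENNReal.coe_toNNReal hfin, mul_comm, ← lintegral_const_mul _ (by fun_prop)]
  exact lintegral_mono_ae (ae_enorm_fourierHat_le f)

lemma integrable_fourierHat {f : R3 → ℂ} (hf : MemLp (weightedFun f) 2)
    (hA : eLpNorm (weightedHat f) ∞ volume ≠ ∞) : Integrable (fourierHat f) := by
  obtain ⟨C, hC⟩ := lintegral_enorm_fourierHat_le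
  refine ⟨(continuous_fourierHat (integrable_of_memLp_weightedFun hf)).aestronglyMeasurable, ?_⟩
  exact (hC f).trans_lt (ENNReal.mul_lt_top ENNReal.coe_lt_top hA.lt_top)

/-- The dispersive estimate for large times. -/
lemma enorm_propagator_le_of_one_le : ∃ C : ℝ≥0, ∀ (f : R3 → ℂ) (t : ℝ) (x : R3),
    MemLp (weightedFun f) 2 → eLpNorm (weightedHat f) ∞ volume ≠ ∞ → 1 ≤ |t| →
    ‖propagator t f x‖ₑ ≤ C * (ENNReal.ofReal ((1 + |t|) ^ (-(3 / 2) : ℝ)) *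
      eLpNorm (weightedHat f) ∞ volume + ENNReal.ofReal ((1 + |t|) ^ (-(31 / 20) : ℝ)) *
        (eLpNorm (weightedFun f) 2 volume + sobolevENorm 50 f)) := by
  obtain ⟨C₁, hC₁⟩ := enorm_integral_cutoff_le
  obtain ⟨C₂, hC₂⟩ := lintegral_one_sub_cutoff_le
  refine ⟨4 * (C₁ + C₂), fun f t x hf hA ht => (enorm_propagator_le t f x).trans ?_⟩
  set T := |t| with hT
  have hT0 : 0 < T := by linarith
  have ht0 : t ≠ 0 := abs_pos.1 hT0
  set A := eLpNorm (weightedHat f) ∞ volume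
  set N := eLpNorm (weightedFun f) 2 volume
  set S := sobolevENorm 50 f
  -- The low-frequency remainder becomes `T^(1/6 - 7/4) = T^(-19/12)` and the high-frequency one
  -- `T^(-48/25)`. Both exponents lie below `-31/20`.
  set K := T ^ (1 / 25 : ℝ) with hK
  have hK1 : 1 ≤ K := Real.one_le_rpow ht (by norm_num)
  -- Factoring `t` out of the total phase leaves `⟨ξ⟩ + (x / t) · ξ`. All previous bounds are
  -- uniform in `c`, hence in `x`.
  set c := t⁻¹ • x with hc
  have hi := integrable_of_memLp_weightedFun hf
  have hgc := continuous_fourierHat hi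
  have hphase : ∀ ξ, Complex.exp (Complex.I * ((inner ℝ x ξ : ℝ) : ℂ)) *
      (Complex.exp (Complex.I * (t : ℂ) * (japaneseBracket ξ : ℂ)) * fourierHat f ξ) =
      phaseExp t c ξ * fourierHat f ξ := by
    intro ξ
    rw [← mul_assoc, ← Complex.exp_add, phaseExp, hc, real_inner_smul_left]
    congr 2
    have : (t : ℂ) ≠ 0 := by exact_mod_cast ht0
    push_cast
    field_simp
    ring
  rw [integral_congr_ae (Filter.Eventually.of_forall hphase)]
  have e1 : K ^ (25 / 6 : ℝ) * T ^ (-(7 / 4) : ℝ) ≤ T ^ (-(31 / 20) : ℝ) := by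
    rw [hK, ← Real.rpow_mul hT0.le, ← Real.rpow_add hT0]
    exact Real.rpow_le_rpow_of_exponent_le ht (by norm_num)
  have e2 : (K ^ 48)⁻¹ ≤ T ^ (-(31 / 20) : ℝ) := by
    rw [hK, ← Real.rpow_natCast, ← Real.rpow_mul hT0.le, ← Real.rpow_neg hT0.le]
    exact Real.rpow_le_rpow_of_exponent_le ht (by norm_num)
  have four : ∀ s : ℝ, 0 ≤ s → s ≤ 2 →
      ENNReal.ofReal (T ^ (-s)) ≤ 4 * ENNReal.ofReal ((1 + T) ^ (-s)) := by
    intro s hs0 hs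
    refine (ENNReal.ofReal_le_ofReal (rpow_neg_le_four_mul ht hs0 hs)).trans (le_of_eq ?_)
    rw [ENNReal.ofReal_mul (by norm_num), ENNReal.ofReal_ofNat]
  have low := hC₁ f t c K hf ht hK1
  have high := hC₂ f K hi hK1
  have hg := integrable_fourierHat hf hA
  have hχc : Continuous (cutoff K) := (contDiff_cutoff K (n := 0)).continuous
  have hE : Continuous (phaseExp t c) := (contDiff_phaseExp t c (n := 0)).continuous
  have i1 : Integrable (fun ξ => phaseExp t c ξ * (cutoff K ξ * fourierHat f ξ)) :=
    hg.mono (hE.mul (hχc.mul hgc)).aestronglyMeasurable (Filter.Eventually.of_forall fun ξ => by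
      rw [norm_mul, norm_phaseExp, one_mul, norm_mul]
      exact mul_le_of_le_one_left (norm_nonneg _) (norm_cutoff_le_one K ξ))
  have i2 : Integrable (fun ξ => phaseExp t c ξ * ((1 - cutoff K ξ) * fourierHat f ξ)) :=
    hg.mono (hE.mul ((continuous_const.sub hχc).mul hgc)).aestronglyMeasurable
      (Filter.Eventually.of_forall fun ξ => by
        rw [norm_mul, norm_phaseExp, one_mul, norm_mul]
        exact mul_le_of_le_one_left (norm_nonneg _) (norm_one_sub_cutoff_le_one K ξ))
  have split : ∫ ξ, phaseExp t c ξ * fourierHat f ξ =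
      (∫ ξ, phaseExp t c ξ * (cutoff K ξ * fourierHat f ξ)) +
        ∫ ξ, phaseExp t c ξ * ((1 - cutoff K ξ) * fourierHat f ξ) := by
    rw [← integral_add i1 i2]
    refine integral_congr_ae (Filter.Eventually.of_forall fun ξ => ?_)
    simp only
    ring
  have high' : ‖∫ ξ, phaseExp t c ξ * ((1 - cutoff K ξ) * fourierHat f ξ)‖ₑ ≤
      C₂ * (ENNReal.ofReal ((K ^ 48)⁻¹) * S) := by
    refine (enorm_integral_le_lintegral_enorm _).trans (le_trans (le_of_eq ?_) high)
    refine lintegral_congr fun ξ => ?_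
    rw [enorm_mul, ← ofReal_norm (phaseExp t c ξ), norm_phaseExp, ENNReal.ofReal_one, one_mul]
  have f1 := four (3 / 2) (by norm_num) (by norm_num)
  have f2 := four (31 / 20) (by norm_num) (by norm_num)
  have f3 := (ENNReal.ofReal_le_ofReal e1).trans f2
  have f4 := (ENNReal.ofReal_le_ofReal e2).trans f2
  set T₁ := ENNReal.ofReal ((1 + T) ^ (-(3 / 2) : ℝ))
  set T₂ := ENNReal.ofReal ((1 + T) ^ (-(31 / 20) : ℝ))
  rw [split]
  calc _ ≤ C₁ * (A * (4 * T₁) + 4 * T₂ * N) + C₂ * (4 * T₂ * S) := by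
        refine (enorm_add_le _ _).trans (add_le_add (low.trans ?_) (high'.trans ?_))
        · gcongr
        · gcongr
    _ = 4 * (C₁ * (T₁ * A + T₂ * N) + C₂ * (T₂ * S)) := by ring
    _ ≤ 4 * (C₁ * (T₁ * A + T₂ * (N + S)) + C₂ * (T₁ * A + T₂ * (N + S))) := by
        gcongr
        · exact le_self_add
        · exact le_add_self.trans (add_le_add_right (mul_le_mul_right le_add_self _) _)
    _ = _ := by push_cast; ring

end

/-- The two hypotheses say that the first two norms on the right-hand side are finite; they make
`f` and `f̂` integrable, so that all integrals involved converge absolutely. -/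
theorem proposition3p1 :
    ∃ C : ℝ≥0, ∀ (f : R3 → ℂ),
      MemLp (weightedFun f) 2 volume →
      MemLp (weightedHat f) ∞ volume →
      ∀ t : ℝ,
        eLpNorm (propagator t f) ∞ volume ≤
          C * (ENNReal.ofReal ((1 + |t|) ^ (-(3 / 2) : ℝ)) * eLpNorm (weightedHat f) ∞ volume
            + ENNReal.ofReal ((1 + |t|) ^ (-(31 / 20) : ℝ)) *
              (eLpNorm (weightedFun f) 2 volume + sobolevENorm 50 f)) := by
  obtain ⟨C₁, hC₁⟩ := enorm_propagator_le_of_one_le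
  obtain ⟨C₂, hC₂⟩ := lintegral_enorm_fourierHat_le
  refine ⟨C₁ + 4 * C₂, fun f hf hA t => ?_⟩
  rw [eLpNorm_exponent_top]
  refine eLpNormEssSup_le_of_ae_enorm_bound (Filter.Eventually.of_forall fun x => ?_)
  push_cast
  rw [add_mul]
  rcases le_or_gt 1 |t| with ht | ht
  · exact (hC₁ f t x hf hA.eLpNorm_ne_top ht).trans le_self_add
  · refine le_add_left ?_
    -- For `|t| < 1` no decay is required: the time factor is bounded below, and the absolute
    -- integral of the transform is controlled by the weighted sup norm.
    have h4 : 1 ≤ 4 * ENNReal.ofReal ((1 + |t|) ^ (-(3 / 2) : ℝ)) := by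
      rw [← ENNReal.ofReal_ofNat 4, ← ENNReal.ofReal_mul (by norm_num)]
      refine ENNReal.one_le_ofReal.2 ?_
      rw [Real.rpow_neg (by positivity), ← div_eq_mul_inv, one_le_div (by positivity)]
      calc (1 + |t|) ^ (3 / 2 : ℝ) ≤ 2 ^ (3 / 2 : ℝ) :=
            Real.rpow_le_rpow (by positivity) (by linarith) (by norm_num)
        _ ≤ 2 ^ (2 : ℝ) := Real.rpow_le_rpow_of_exponent_le (by norm_num) (by norm_num)
        _ = 4 := by norm_num
    set A := eLpNorm (weightedHat f) ∞ volume
    set T₁ := ENNReal.ofReal ((1 + |t|) ^ (-(3 / 2) : ℝ))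
    calc ‖propagator t f x‖ₑ ≤ ∫⁻ ξ, ‖fourierHat f ξ‖ₑ := by
          refine (enorm_propagator_le t f x).trans
            ((enorm_integral_le_lintegral_enorm _).trans (le_of_eq ?_))
          refine lintegral_congr fun ξ => ?_
          rw [← ofReal_norm, ← ofReal_norm, norm_mul, norm_mul, mul_comm Complex.I,
            Complex.norm_exp_ofReal_mul_I, mul_comm Complex.I, mul_right_comm, ← Complex.ofReal_mul,
            Complex.norm_exp_ofReal_mul_I, one_mul, one_mul]
      _ ≤ C₂ * A := hC₂ f
      _ = 1 * (C₂ * A) := (one_mul _).symm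
      _ ≤ 4 * T₁ * (C₂ * A) := mul_le_mul_left h4 _
      _ = 4 * C₂ * (T₁ * A) := by ring
      _ ≤ _ := mul_le_mul_right le_self_add _
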